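/- Let $R$ be a noetherian integral domain with fraction field $K$, put $X=\operatorname{Spec}(R)$, and let $A$ be an associative unital $R$-algebra that is finitely generated and free as an $R$-module. For a commutative $R$-algebra $S$ write $A^S=S\otimes_R A$. For $\mathfrak p\in X$ with residue field $k(\mathfrak p)$ let $A(\mathfrak p)=A^{k(\mathfrak p)}$ be the fiber, and let $A|_{\mathfrak p}=(R/\mathfrak p)\otimes_R A$, an algebra over $R/\mathfrak p$. A finite-dimensional algebra $B$ over a field $k$ *splits* if $\operatorname{End}_B(V)=k$ for every simple $B$-module $V$. For a field $k$ over $R$, $\mathrm G_0(A^k)$ denotes the Grothendieck group of the finite-dimensional $A^k$-modules, modulo short exact sequences. For a field extension $L/k$ the map $[V]\mapsto[L\otimes_k V]$ embeds $\mathrm G_0(A^k)$ into $\mathrm G_0(A^L)$. An *$A$-gate* in $\mathfrak p\in X$ is a local ring $R\subseteq\mathcal O\subseteq K$ with maximal ideal $\mathfrak m$ and residue field $k(\mathfrak m)=\mathcal O/\mathfrak m$ such that 1. $R\cap\mathfrak m=\mathfrak p$; 2. every finite-dimensional $A^K$-module $V$ has an $\mathcal O$-free $A^{\mathcal O}$-form,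 i.e. an $A^{\mathcal O}$-module $\widetilde V$, free over $\mathcal O$, with $K\otimes_{\mathcal O}\widetilde V\cong V$ as $A^K$-modules; 3. for every $A^{\mathcal O}$-module $\widetilde V$ that is free of finite rank over $\mathcal O$, the class $[\widetilde V/\mathfrak m\widetilde V]$ lies in the subgroup $\mathrm G_0(A(\mathfrak p))$ of $\mathrm G_0(A^{k(\mathfrak m)})$. The decomposition map $\mathrm d_A^{\mathfrak p,\mathcal O}:\mathrm G_0(A^K)\to\mathrm G_0(A(\mathfrak p))$ with respect to an $A$-gate $\mathcal O$ is the homomorphism with $\mathrm d_A^{\mathfrak p,\mathcal O}([V])=[\widetilde V/\mathfrak m\widetilde V]$ for every finite-dimensional $A^K$-module $V$ and every $\mathcal O$-free $A^{\mathcal O}$-form $\widetilde V$ of $V$. It is *trivial* if it induces a bijection between the isomorphism classes of simple $A^K$-modules and those of simple $A(\mathfrak p)$-modules. Let $$\mathrm{DecGen}(A)=\{\mathfrak p\in X \mid \text{there is an $A$-gate in } \mathfrak p, \text{ and } \mathrm d_A^{\mathfrak p,\mathcal O} \text{ exists and is trivial for every $A$-gate } \mathcal O \text{ in } \mathfrak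 p\}.$$ For $\xi\in X$ regard $\mathrm{DecGen}(A|_\xi)\subseteq\operatorname{Spec}(R/\xi)$ as a subset of $X$ by identifying $\operatorname{Spec}(R/\xi)$ with the closure of $\xi$ in $X$. **Theorem.** Suppose that $A(\mathfrak p)$ splits for all $\mathfrak p\in X$. Then $\mathrm{DecGen}(A)$ is an open subset of $X$ containing the generic point. Moreover, there are finitely many points $\xi_1,\dots,\xi_n\in X$ such that $$X=\bigcup_{i=1}^n\mathrm{DecGen}(A|_{\xi_i}),$$ and the sets $\mathrm{DecGen}(A|_{\xi_i})$ are locally closed in $X$. Consequently, there is a finite stratification of $X$ (finitely many pairwise disjoint non-empty locally closed subsets covering $X$, the closure of each being a union of some of them) such that each stratum is contained in some $\mathrm{DecGen}(A|_{\xi_i})$; and the complement $X\setminus\mathrm{DecGen}(A)$ is the zero locus of an ideal of $R$, namely of the *decomposition discriminant* $\mathfrak d_A$, the radical ideal of all $f\in R$ that are contained in every prime of $X\setminus\mathrm{DecGen}(A)$. -/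

import Mathlib

open scoped TensorProduct

universe u v

namespace DecompositionMaps

noncomputable section

/-! ### Modules over `A^S = S ⊗[R] A` that are finite free over `S` -/

/-- An `A^S`-module, where `A^S = S ⊗[R] A`, which is finitely generated and free as an `S`-module.
If `S` is a field, this is the same as a finite-dimensional `A^S`-module. -/
structure FreeMod (R : Type u) [CommRing R] (A : Type v) [Ring A] [Algebra R A]
    (S : Type u) [CommRing S] [Algebra R S] where
  carrier : Type (max u v)
  [addCommGroup : AddCommGroup carrier]
  [moduleBase : Module S carrier]
  [module : Module (S ⊗[R] A) carrier]
  [isScalarTower : IsScalarTower S (S ⊗[R] A) carrier]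
  [finite : Module.Finite S carrier]
  [free : Module.Free S carrier]

namespace FreeMod

attribute [instance] addCommGroup moduleBase module isScalarTower finite free

variable {R : Type u} [CommRing R] {A : Type v} [Ring A] [Algebra R A]
variable {S : Type u} [CommRing S] [Algebra R S]
variable (T : Type u) [CommRing T] [Algebra R T] [Algebra S T] [IsScalarTower R S T]

/-- The canonical map `A^T → T ⊗[S] A^S`, `t ⊗ a ↦ t ⊗ (1 ⊗ a)`. -/
def toBaseChange : T ⊗[R] A →ₐ[T] T ⊗[S] (S ⊗[R] A) :=
  Algebra.TensorProduct.lift (Algebra.ofId T (T ⊗[S] (S ⊗[R] A)))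
    (((Algebra.TensorProduct.includeRight :
      (S ⊗[R] A) →ₐ[S] T ⊗[S] (S ⊗[R] A)).restrictScalars R).comp
        Algebra.TensorProduct.includeRight)
    fun _ _ => Algebra.commutes _ _

/-- The action of `A^T` on the scalar extension `T ⊗[S] V` of an `A^S`-module `V`: the element
`t ⊗ a` acts as `t' ⊗ x ↦ t t' ⊗ (1 ⊗ a) x`. -/
def extendAction (V : FreeMod R A S) : T ⊗[R] A →ₐ[T] Module.End T (T ⊗[S] V.carrier) :=
  (LinearMap.tensorProductEnd S T V.carrier).comp
    ((Algebra.TensorProduct.map (AlgHom.id T T) (Algebra.lsmul S S V.carrier)).comp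
      (toBaseChange T))

theorem extendAction_tmul (V : FreeMod R A S) (t : T) (a : A) (t' : T) (x : V.carrier) :
    extendAction T V (t ⊗ₜ a) (t' ⊗ₜ x) = (t * t') ⊗ₜ (((1 : S) ⊗ₜ[R] a : S ⊗[R] A) • x) := by
  have h : toBaseChange (R := R) (A := A) (S := S) T (t ⊗ₜ[R] a)
      = t ⊗ₜ[S] ((1 : S) ⊗ₜ[R] a) := by
    refine (Algebra.TensorProduct.lift_tmul _ _ _ t a).trans ?_
    simp [Algebra.ofId_apply]
  have h' (g : Module.End S V.carrier) :
      LinearMap.tensorProductEnd S T V.carrier (t ⊗ₜ g) (t' ⊗ₜ x) = (t * t') ⊗ₜ g x := rfl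
  change LinearMap.tensorProductEnd S T V.carrier
    (Algebra.TensorProduct.map (AlgHom.id T T) (Algebra.lsmul S S V.carrier)
      (toBaseChange (R := R) (A := A) (S := S) T (t ⊗ₜ[R] a))) (t' ⊗ₜ x) = _
  rw [h, Algebra.TensorProduct.map_tmul]
  exact h' _

/-- The scalar extension `V^T = T ⊗[S] V`, as a module over `A^T`. -/
def extend (V : FreeMod R A S) : FreeMod R A T :=
  letI : Module (T ⊗[R] A) (T ⊗[S] V.carrier) :=
    Module.compHom (T ⊗[S] V.carrier) (extendAction T V).toRingHom
  haveI : IsScalarTower T (T ⊗[R] A) (T ⊗[S] V.carrier) := ⟨fun t b x => by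
    change extendAction T V (t • b) x = t • extendAction T V b x
    rw [map_smul, LinearMap.smul_apply]⟩
  { carrier := T ⊗[S] V.carrier }

theorem smul_extend (V : FreeMod R A S) (t : T) (a : A) (t' : T) (x : V.carrier) :
    ((t ⊗ₜ[R] a : T ⊗[R] A) • (show (extend T V).carrier from t' ⊗ₜ[S] x)) =
      (show (extend T V).carrier from
        (t * t') ⊗ₜ[S] (((1 : S) ⊗ₜ[R] a : S ⊗[R] A) • x)) :=
  extendAction_tmul T V t a t' x

/-- The scalar extension of a homomorphism of `A^S`-modules. -/
def extendMap {V W : FreeMod R A S} (f : V.carrier →ₗ[S ⊗[R] A] W.carrier) :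
    (extend T V).carrier →ₗ[T ⊗[R] A] (extend T W).carrier where
  toFun x := (f.restrictScalars S).baseChange T x
  map_add' x y := map_add ((f.restrictScalars S).baseChange T) x y
  map_smul' b x := by
    change (f.restrictScalars S).baseChange T (extendAction T V b x) =
      extendAction T W b ((f.restrictScalars S).baseChange T x)
    revert x
    change ∀ x : T ⊗[S] V.carrier, _
    intro x
    induction b with
    | zero => simp
    | add b c hb hc => simp only [map_add, LinearMap.add_apply, hb, hc]
    | tmul t a =>
      induction x with
      | zero => simp
      | add x y hx hy => simp only [map_add, hx, hy]
      | tmul t' x => simp [extendAction_tmul]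

end FreeMod

/-! ### Grothendieck groups -/

section Grothendieck

variable (R : Type u) [CommRing R] (A : Type v) [Ring A] [Algebra R A]

/-- The relations `[V₂] = [V₁] + [V₃]` for the short exact sequences `0 → V₁ → V₂ → V₃ → 0` of
finite-dimensional `A^k`-modules. -/
def exactRelations (k : Type u) [Field k] [Algebra R k] :
    Set (FreeAbelianGroup (FreeMod R A k)) :=
  {r | ∃ (V₁ V₂ V₃ : FreeMod R A k)
    (f : V₁.carrier →ₗ[k ⊗[R] A] V₂.carrier) (g : V₂.carrier →ₗ[k ⊗[R] A] V₃.carrier),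
    Function.Injective f ∧ Function.Exact f g ∧ Function.Surjective g ∧
    r = FreeAbelianGroup.of V₂ - (FreeAbelianGroup.of V₁ + FreeAbelianGroup.of V₃)}

/-- The Grothendieck group `G₀(A^k)` of the category of finite-dimensional `A^k`-modules. -/
abbrev G0 (k : Type u) [Field k] [Algebra R k] : Type _ :=
  FreeAbelianGroup (FreeMod R A k) ⧸ AddSubgroup.closure (exactRelations R A k)

variable {R A}

/-- The class `[V]` in the Grothendieck group. -/
def G0.cls {k : Type u} [Field k] [Algebra R k] (V : FreeMod R A k) : G0 R A k :=
  QuotientAddGroup.mk (FreeAbelianGroup.of V)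

theorem G0.cls_eq_add {k : Type u} [Field k] [Algebra R k] {V₁ V₂ V₃ : FreeMod R A k}
    (f : V₁.carrier →ₗ[k ⊗[R] A] V₂.carrier) (g : V₂.carrier →ₗ[k ⊗[R] A] V₃.carrier)
    (hf : Function.Injective f) (hfg : Function.Exact f g) (hg : Function.Surjective g) :
    G0.cls V₂ = G0.cls V₁ + G0.cls V₃ := by
  rw [← sub_eq_zero]
  exact (QuotientAddGroup.eq_zero_iff _).2
    (AddSubgroup.subset_closure ⟨V₁, V₂, V₃, f, g, hf, hfg, hg, rfl⟩)

variable (R A)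

/-- The set of the classes of the simple `A^k`-modules in `G₀(A^k)`. -/
def simpleClasses (k : Type u) [Field k] [Algebra R k] : Set (G0 R A k) :=
  {x | ∃ V : FreeMod R A k, IsSimpleModule (k ⊗[R] A) V.carrier ∧ x = G0.cls V}

/-- The homomorphism `G₀(A^k) → G₀(A^L)`, `[V] ↦ [L ⊗ V]`, induced by a field extension `L / k`. -/
def G0.extend (k L : Type u) [Field k] [Algebra R k] [Field L] [Algebra R L] [Algebra k L]
    [IsScalarTower R k L] : G0 R A k →+ G0 R A L :=
  QuotientAddGroup.lift (AddSubgroup.closure (exactRelations R A k))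
    (FreeAbelianGroup.lift fun V : FreeMod R A k => G0.cls (V.extend L)) <| by
    rw [AddSubgroup.closure_le]
    rintro _ ⟨V₁, V₂, V₃, f, g, hf, hfg, hg, rfl⟩
    rw [SetLike.mem_coe, AddMonoidHom.mem_ker, map_sub, map_add, FreeAbelianGroup.lift_apply_of,
      FreeAbelianGroup.lift_apply_of, FreeAbelianGroup.lift_apply_of, sub_eq_zero]
    refine G0.cls_eq_add (FreeMod.extendMap L f) (FreeMod.extendMap L g) ?_ ?_ ?_
    · exact Module.Flat.lTensor_preserves_injective_linearMap (M := L) (f.restrictScalars k) hf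
    · exact Module.Flat.lTensor_exact (M := L) (f := f.restrictScalars k)
        (g := g.restrictScalars k) hfg
    · exact LinearMap.lTensor_surjective L (g := g.restrictScalars k) hg

theorem G0.extend_cls (k L : Type u) [Field k] [Algebra R k] [Field L] [Algebra R L] [Algebra k L]
    [IsScalarTower R k L] (V : FreeMod R A k) :
    G0.extend R A k L (G0.cls V) = G0.cls (V.extend L) := by
  simp [G0.extend, G0.cls]

end Grothendieck

/-! ### Split algebras -/

/-- A (finite-dimensional) algebra `B` over a field `k` *splits* if `End_B(V) = k` for any simple
`B`-module `V`. -/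
def IsSplit (k : Type u) [Field k] (B : Type v) [Ring B] [Algebra k B] : Prop :=
  ∀ (V : Type v) [AddCommGroup V] [Module B V] [IsSimpleModule B V] (f : V →ₗ[B] V),
    ∃ c : k, ∀ x : V, f x = algebraMap k B c • x

/-! ### Gates and decomposition maps -/

section Gates

variable {R : Type u} [CommRing R]

/-- A local ring `𝒪` between `R` and its fraction field whose maximal ideal `𝔪` satisfies
`R ∩ 𝔪 = 𝔭`. -/
structure LocalOver (p : PrimeSpectrum R) where
  ring : Subalgebra R (FractionRing R)
  [isLocalRing : IsLocalRing ring]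
  comap_eq : (IsLocalRing.maximalIdeal ring).comap (algebraMap R ring) = p.asIdeal

attribute [instance] LocalOver.isLocalRing

namespace LocalOver

variable {p : PrimeSpectrum R} (O : LocalOver p)

/-- The residue field `k(𝔪) = 𝒪 / 𝔪`. -/
abbrev kappa : Type u := IsLocalRing.ResidueField O.ring

theorem algebraMap_eq_zero_iff (r : R) : algebraMap R O.kappa r = 0 ↔ r ∈ p.asIdeal := by
  rw [← O.comap_eq, Ideal.mem_comap, ← IsLocalRing.residue_eq_zero_iff]
  rfl

/-- The embedding `k(𝔭) → k(𝔪)` of residue fields. -/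
instance : Algebra p.asIdeal.ResidueField O.kappa :=
  (Ideal.ResidueField.lift p.asIdeal (algebraMap R O.kappa)
    (fun r hr => (O.algebraMap_eq_zero_iff r).2 hr)
    (fun r hr => isUnit_iff_ne_zero.2 fun h => hr ((O.algebraMap_eq_zero_iff r).1 h))).toAlgebra

instance : IsScalarTower R p.asIdeal.ResidueField O.kappa :=
  IsScalarTower.of_algebraMap_eq fun r =>
    (Ideal.ResidueField.lift_algebraMap (I := p.asIdeal) _ _ _ r).symm

variable (A : Type v) [Ring A] [Algebra R A]

/-- The ring `𝒪` is a *weak `A`-gate* in `𝔭` if every finite-dimensional `A^K`-module `V` has an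
`𝒪`-free `A^𝒪`-form. -/
def IsWeakGate : Prop :=
  ∀ V : FreeMod R A (FractionRing R), ∃ W : FreeMod R A O.ring,
    Nonempty ((W.extend (FractionRing R)).carrier ≃ₗ[FractionRing R ⊗[R] A] V.carrier)

/-- The ring `𝒪` is an *`A`-gate* in `𝔭` if it is a weak `A`-gate in `𝔭` and the class of the
reduction `W / 𝔪 W = k(𝔪) ⊗ W` of every `𝒪`-free `A^𝒪`-module `W` of finite rank lies in the
subgroup `G₀(A(𝔭))` of `G₀(A^𝒪(𝔪))`. -/
def IsGate : Prop :=
  O.IsWeakGate A ∧ ∀ W : FreeMod R A O.ring,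
    G0.cls (W.extend O.kappa) ∈ (G0.extend R A p.asIdeal.ResidueField O.kappa).range

variable [IsDomain R]

/-- The homomorphism `d : G₀(A^K) → G₀(A(𝔭))` is the decomposition map of `A` in `𝔭` with respect
to `𝒪`: the image of `d [V]` in `G₀(A^𝒪(𝔪))` is `[W / 𝔪 W]` for all finite-dimensional
`A^K`-modules `V` and all `𝒪`-free `A^𝒪`-forms `W` of `V`. -/
def IsDecompositionMap (d : G0 R A (FractionRing R) →+ G0 R A p.asIdeal.ResidueField) : Prop :=
  ∀ (V : FreeMod R A (FractionRing R)) (W : FreeMod R A O.ring),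
    Nonempty ((W.extend (FractionRing R)).carrier ≃ₗ[FractionRing R ⊗[R] A] V.carrier) →
      G0.extend R A p.asIdeal.ResidueField O.kappa (d (G0.cls V)) = G0.cls (W.extend O.kappa)

/-- The decomposition map with respect to `𝒪` exists and is trivial, i.e. it induces a bijection
between the isomorphism classes of simple `A^K`-modules and those of simple `A(𝔭)`-modules. -/
def HasTrivialDecompositionMap : Prop :=
  ∃ d : G0 R A (FractionRing R) →+ G0 R A p.asIdeal.ResidueField, O.IsDecompositionMap A d ∧
    Set.BijOn d (simpleClasses R A (FractionRing R)) (simpleClasses R A p.asIdeal.ResidueField)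

end LocalOver

end Gates

/-! ### The set `DecGen` -/

section DecGen

variable (R : Type u) [CommRing R]

/-- `DecGen(A)`: the set of primes `𝔭` of `R` in which there is an `A`-gate and such that the
decomposition map of `A` in `𝔭` is trivial for every `A`-gate in `𝔭`. -/
def decGen [IsDomain R] (A : Type v) [Ring A] [Algebra R A] : Set (PrimeSpectrum R) :=
  {p | (∃ O : LocalOver p, O.IsGate A) ∧
    ∀ O : LocalOver p, O.IsGate A → O.HasTrivialDecompositionMap A}

/-- `DecGen(A|_ξ)` for the `R/ξ`-algebra `A|_ξ = R/ξ ⊗ A`, viewed as a subset of `Spec(R)` through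
the identification of `Spec(R/ξ)` with the closure `V(ξ)` of `ξ`. -/
def decGenAt (A : Type v) [Ring A] [Algebra R A] (ξ : PrimeSpectrum R) : Set (PrimeSpectrum R) :=
  PrimeSpectrum.comap (Ideal.Quotient.mk ξ.asIdeal) ''
    decGen (R ⧸ ξ.asIdeal) ((R ⧸ ξ.asIdeal) ⊗[R] A)

/-- The decomposition discriminant of `A`: the radical ideal of all elements of `R` that vanish on
the complement of `DecGen(A)`. -/
def decDiscriminant [IsDomain R] (A : Type v) [Ring A] [Algebra R A] : Ideal R :=
  PrimeSpectrum.vanishingIdeal (decGen R A)ᶜ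

end DecGen

/-- A finite stratification of a topological space `X`: finitely many pairwise disjoint non-empty
locally closed subsets that cover `X`, such that the closure of each of them is a union of some of
them. -/
structure IsFiniteStratification {X : Type u} [TopologicalSpace X] (𝒮 : Set (Set X)) : Prop where
  finite : 𝒮.Finite
  nonempty : ∀ Y ∈ 𝒮, Y.Nonempty
  pairwiseDisjoint : 𝒮.PairwiseDisjoint id
  sUnion_eq : ⋃₀ 𝒮 = Set.univ
  isLocallyClosed : ∀ Y ∈ 𝒮, IsLocallyClosed Y
  closure_eq : ∀ Y ∈ 𝒮, ∃ 𝒯 ⊆ 𝒮, closure Y = ⋃₀ 𝒯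

end

end DecompositionMaps

open DecompositionMaps

/-! Everything is read off one function on X: F(𝔭) = dim A(𝔭)/Rad A(𝔭) (`fiberRank`), which by
splitting is the sum of the squares of the dimensions of the simple A(𝔭)-modules.

Let 𝒪 be a weak gate in 𝔭, let n i be the dimensions of the simple A^K-modules and m j those of the
simple A(𝔭)-modules. The decomposition map is a matrix c of natural numbers with n i = ∑ j, c i j *
m j. No column of c is zero, because every simple module occurs in the reduction of A^𝒪. Elementary
estimates then give ∑ m j ^ 2 ≤ ∑ n i ^ 2, with equality exactly if c is a permutation matrix
(`exists_bijective_of_decomposition`). Hence triviality does not depend on 𝒪, and DecGen(A) is the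
set where F takes its generic value (`mem_decGen_iff`).

Gates exist: a valuation ring dominating R_𝔭 is a weak gate, and since A(𝔭) splits, extending
scalars to k(𝔪) is an isomorphism on G₀, which makes the third gate condition automatic. The
decomposition map exists without any normality of 𝒪: over a split algebra the multiplicity of a
simple module is the multiplicity of the eigenvalue 1 of a primitive idempotent, and the
characteristic polynomial of a lift of this idempotent to A^𝒪 is determined by the generic fibre.

Applied to A|_ξ, the inequality says that F decreases under specialization (`fiberRank_antitone`).
Spreading out a surjection of A(ξ) onto matrix algebras (`exists_radRank_le`) shows that F is
constant on a non-empty open part of each closure V(ξ). By noetherian induction the sets {F < c} are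
closed, which gives openness and local closedness. For the stratification, the generic points of the
sets {F ≤ c} are enlarged to a finite set of primes such that intersections of closures are unions
of closures (`exists_isInterClosed`). -/

namespace DecompositionMaps

noncomputable section

/-! ### Split algebras and the rank of the semisimple quotient -/

section Radical

/-- The dimension of the largest semisimple quotient `B / Rad B` of a `k`-algebra `B`. -/
def radRank (k : Type*) [Field k] (B : Type*) [Ring B] [Algebra k B] : ℕ :=
  Module.finrank k (B ⧸ Ring.jacobson B)

theorem finrank_pi_matrix (k : Type*) [Field k] {ι : Type*} [Fintype ι] (n : ι → ℕ) :
    Module.finrank k (∀ i, Matrix (Fin (n i)) (Fin (n i)) k) = ∑ i, n i ^ 2 := by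
  rw [Module.finrank_pi_fintype]
  refine Finset.sum_congr rfl fun i _ => ?_
  rw [Module.finrank_matrix]
  simp [sq]

theorem bijective_algebraMap_end (k : Type u) [Field k] (B : Type v) [Ring B] [Algebra k B]
    (h : IsSplit k B) (S : Ideal (B ⧸ Ring.jacobson B))
    [IsSimpleModule (B ⧸ Ring.jacobson B) S] :
    Function.Bijective (algebraMap k (Module.End (B ⧸ Ring.jacobson B) S)ᵐᵒᵖ) := by
  have : Nontrivial S := IsSimpleModule.nontrivial (B ⧸ Ring.jacobson B) S
  refine ⟨(algebraMap k (Module.End (B ⧸ Ring.jacobson B) S)ᵐᵒᵖ).injective, fun f => ?_⟩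
  -- Splitting is a statement about simple B-modules, so S is inflated along B → B/Rad B.
  let : Module B S := Module.compHom S (Ideal.Quotient.mk (Ring.jacobson B))
  let e : S →ₛₗ[Ideal.Quotient.mk (Ring.jacobson B)] S :=
    { toFun := id, map_add' := fun _ _ => rfl, map_smul' := fun _ _ => rfl }
  have : RingHomSurjective (Ideal.Quotient.mk (Ring.jacobson B)) :=
    ⟨Ideal.Quotient.mk_surjective⟩
  have : IsSimpleModule B S :=
    (LinearMap.isSimpleModule_iff_of_bijective e Function.bijective_id).2 inferInstance
  obtain ⟨c, hc⟩ := h S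
    { toFun := f.unop, map_add' := map_add _, map_smul' := fun b x =>
        f.unop.map_smul (Ideal.Quotient.mk (Ring.jacobson B) b) x }
  refine ⟨c, ?_⟩
  apply MulOpposite.unop_injective
  ext x : 1
  rw [MulOpposite.algebraMap_apply, MulOpposite.unop_op, Module.algebraMap_end_apply]
  refine Eq.trans ?_ (hc x).symm
  apply Subtype.ext
  obtain ⟨y, hy⟩ := Ideal.Quotient.mk_surjective x.1
  change c • x.1 = Ideal.Quotient.mk (Ring.jacobson B) (algebraMap k B c) • x.1
  rw [← hy, smul_eq_mul, ← map_mul, Algebra.smul_def]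
  rfl

/-- The semisimple quotient of a finite-dimensional split algebra is a product of matrix rings. -/
theorem IsSplit.exists_surjective_pi_matrix (k : Type u) [Field k] (B : Type v) [Ring B]
    [Algebra k B] [Module.Finite k B] (h : IsSplit k B) :
    ∃ (m : ℕ) (n : Fin m → ℕ) (ρ : B →ₐ[k] ∀ i, Matrix (Fin (n i)) (Fin (n i)) k),
      (∀ i, NeZero (n i)) ∧ Function.Surjective ρ ∧ RingHom.ker ρ = Ring.jacobson B := by
  have : IsArtinianRing B := IsArtinianRing.of_finite k B
  have : IsSemisimpleRing (B ⧸ Ring.jacobson B) := inferInstance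
  obtain ⟨m, S, n, hS, hn, ⟨e⟩⟩ :=
    IsSemisimpleRing.exists_algEquiv_pi_matrix_end_mulOpposite k (B ⧸ Ring.jacobson B)
  let g (i : Fin m) : (Module.End (B ⧸ Ring.jacobson B) (S i))ᵐᵒᵖ ≃ₐ[k] k :=
    (AlgEquiv.ofBijective (Algebra.ofId k _) (bijective_algebraMap_end k B h (S i))).symm
  let e' := e.trans (AlgEquiv.piCongrRight fun i => (g i).mapMatrix (m := Fin (n i)))
  refine ⟨m, n, (e' : _ →ₐ[k] _).comp (Ideal.Quotient.mkₐ k (Ring.jacobson B)), hn, ?_, ?_⟩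
  · exact e'.surjective.comp Ideal.Quotient.mk_surjective
  · ext x
    rw [RingHom.mem_ker]
    change e' (Ideal.Quotient.mk (Ring.jacobson B) x) = 0 ↔ _
    rw [map_eq_zero_iff _ e'.injective, Ideal.Quotient.eq_zero_iff_mem]

theorem finrank_eq_of_surjective (k : Type*) [Field k] {B C : Type*} [Ring B] [Algebra k B]
    [Ring C] [Algebra k C] (ρ : B →ₐ[k] C) (hρ : Function.Surjective ρ)
    (hk : RingHom.ker ρ = Ring.jacobson B) : radRank k B = Module.finrank k C := by
  rw [radRank, ← hk]
  exact (Ideal.quotientKerAlgEquivOfSurjective hρ).toLinearEquiv.finrank_eq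

theorem finrank_le_radRank (k : Type*) [Field k] {B C : Type*} [Ring B] [Algebra k B]
    [Module.Finite k B] [Ring C] [Algebra k C] [IsSemisimpleRing C] (ρ : B →ₐ[k] C)
    (hρ : Function.Surjective ρ) : Module.finrank k C ≤ radRank k B := by
  have : RingHomSurjective ρ.toRingHom := ⟨hρ⟩
  -- A surjection maps the radical into the radical, and that of a semisimple ring vanishes.
  have hle : Ring.jacobson B ≤ RingHom.ker ρ := by
    have h := Ring.le_comap_jacobson ρ.toRingHom
    rwa [IsSemisimpleRing.jacobson_eq_bot C] at h
  let g : (B ⧸ Ring.jacobson B) →ₐ[k] C := Ideal.Quotient.liftₐ (Ring.jacobson B) ρ hle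
  have hg : Function.Surjective g := fun c => by
    obtain ⟨b, rfl⟩ := hρ c
    exact ⟨Ideal.Quotient.mk _ b, rfl⟩
  exact LinearMap.finrank_le_finrank_of_surjective (f := g.toLinearMap) hg

theorem sum_sq_le_radRank (k : Type*) [Field k] {B : Type*} [Ring B] [Algebra k B]
    [Module.Finite k B] {ι : Type*} [Fintype ι] (n : ι → ℕ)
    (ρ : B →ₐ[k] ∀ i, Matrix (Fin (n i)) (Fin (n i)) k) (hρ : Function.Surjective ρ) :
    ∑ i, n i ^ 2 ≤ radRank k B := by
  classical
  rw [← finrank_pi_matrix k n]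
  exact finrank_le_radRank k ρ hρ

theorem radRank_congr {k k' : Type*} [Field k] [Field k'] {B B' : Type v} [Ring B] [Ring B']
    [Algebra k B] [Algebra k' B'] (e : k ≃+* k') (φ : B ≃+* B')
    (h : ∀ c, φ (algebraMap k B c) = algebraMap k' B' (e c)) : radRank k B = radRank k' B' := by
  have hJ : Ring.jacobson B' = (Ring.jacobson B).map (φ : B →+* B') := by
    have : RingHomSurjective (φ : B →+* B') := ⟨φ.surjective⟩
    have h1 := Ring.map_jacobson_of_ker_le (f := (φ : B →+* B')) (by
      intro x hx
      rw [RingHom.mem_ker] at hx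
      rw [(map_eq_zero_iff _ φ.injective).1 hx]
      exact zero_mem _)
    rw [← h1]
    ext y
    rw [Ideal.mem_map_iff_of_surjective (φ : B →+* B') φ.surjective]
    rfl
  let g := Ideal.quotientEquiv (Ring.jacobson B) (Ring.jacobson B') φ hJ
  refine congrArg Cardinal.toNat (rank_eq_of_equiv_equiv e g.toAddEquiv e.bijective fun c x => ?_)
  obtain ⟨b, rfl⟩ := Ideal.Quotient.mk_surjective x
  change g (Ideal.Quotient.mk _ (c • b)) = e c • g (Ideal.Quotient.mk _ b)
  rw [Ideal.quotientEquiv_mk, Ideal.quotientEquiv_mk, Algebra.smul_def, map_mul, h]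
  change _ = Ideal.Quotient.mk (Ring.jacobson B') (e c • φ b)
  rw [Algebra.smul_def]

theorem IsSplit.congr {k k' : Type u} [Field k] [Field k'] {B B' : Type v} [Ring B] [Ring B']
    [Algebra k B] [Algebra k' B'] (e : k ≃+* k') (φ : B ≃+* B')
    (h : ∀ c, φ (algebraMap k B c) = algebraMap k' B' (e c)) (hB : IsSplit k B) :
    IsSplit k' B' := by
  intro V _ _ _ f
  let : Module B V := Module.compHom V (φ : B →+* B')
  have : RingHomSurjective (φ : B →+* B') := ⟨φ.surjective⟩
  let g : V →ₛₗ[(φ : B →+* B')] V :=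
    { toFun := id, map_add' := fun _ _ => rfl, map_smul' := fun _ _ => rfl }
  have : IsSimpleModule B V :=
    (LinearMap.isSimpleModule_iff_of_bijective g Function.bijective_id).2 inferInstance
  obtain ⟨c, hc⟩ := hB V
    { toFun := f, map_add' := map_add _, map_smul' := fun b x => f.map_smul (φ b) x }
  refine ⟨e c, fun x => (hc x).trans ?_⟩
  rw [← h]
  rfl

end Radical

/-! ### Characteristic polynomials -/

section Charpoly

open Polynomial Module Basis

/-- In a basis adapted to W the matrix of e is block triangular, with the two maps on the right as
diagonal blocks. -/
theorem charpoly_eq_restrict_mul_mapQ {k V : Type*} [Field k] [AddCommGroup V] [Module k V]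
    [Module.Finite k V] (W : Submodule k V) (e : V →ₗ[k] V) (he : W ≤ W.comap e) :
    e.charpoly = (e.restrict he).charpoly * (W.mapQ W e he).charpoly := by
  let m := Module.Free.ChooseBasisIndex k W
  let bW : Basis m k W := Module.Free.chooseBasis k W
  let n := Module.Free.ChooseBasisIndex k (V ⧸ W)
  let bQ : Basis n k (V ⧸ W) := Module.Free.chooseBasis k (V ⧸ W)
  let b := sumQuot bW bQ
  let A : Matrix m m k := LinearMap.toMatrix bW bW (e.restrict he)
  let B : Matrix m n k := Matrix.of fun i l ↦
    ((sumQuot bW bQ).repr (e ((sumQuot bW bQ) (Sum.inr l)))) (Sum.inl i)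
  let D : Matrix n n k := LinearMap.toMatrix bQ bQ (W.mapQ W e he)
  suffices LinearMap.toMatrix b b e = Matrix.fromBlocks A B 0 D by
    rw [← LinearMap.charpoly_toMatrix e b, this, ← LinearMap.charpoly_toMatrix _ bW,
      ← LinearMap.charpoly_toMatrix _ bQ, Matrix.charpoly_fromBlocks_zero₂₁]
  ext u v
  cases u with
  | inl i =>
    cases v with
    | inl l =>
      simp only [b, sumQuot_inl, Matrix.fromBlocks_apply₁₁, A, LinearMap.toMatrix_apply]
      apply sumQuot_repr_inl_of_mem
    | inr l => simp [b, LinearMap.toMatrix_apply, Matrix.fromBlocks_apply₁₂, B]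
  | inr j =>
    cases v with
    | inl l =>
      suffices W.mkQ (e (bW l)) = 0 by simp [LinearMap.toMatrix_apply, b, this]
      rw [← LinearMap.mem_ker, Submodule.ker_mkQ]
      exact he (bW l).2
    | inr l =>
      simp only [b, D, Matrix.fromBlocks_apply₂₂, LinearMap.toMatrix_apply, sumQuot_repr_inr,
        Submodule.mkQ_apply]
      rw [← sumQuot_inr bW bQ l, W.mapQ_apply]

theorem charpoly_eq_of_intertwine {k V W : Type*} [CommRing k] [AddCommGroup V] [Module k V]
    [Module.Finite k V] [Module.Free k V] [AddCommGroup W] [Module k W] [Module.Finite k W]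
    [Module.Free k W] (e : V ≃ₗ[k] W) (a : V →ₗ[k] V) (b : W →ₗ[k] W)
    (h : ∀ x, e (a x) = b (e x)) : a.charpoly = b.charpoly := by
  rw [← LinearEquiv.charpoly_conj e a]
  congr 1
  ext x
  simp [LinearEquiv.conj_apply, h]

theorem charpoly_eq_mul_of_exact {k V₁ V₂ V₃ : Type*} [Field k] [AddCommGroup V₁] [Module k V₁]
    [Module.Finite k V₁] [AddCommGroup V₂] [Module k V₂] [Module.Finite k V₂] [AddCommGroup V₃]
    [Module k V₃] [Module.Finite k V₃] (f : V₁ →ₗ[k] V₂) (g : V₂ →ₗ[k] V₃)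
    (hf : Function.Injective f) (hfg : Function.Exact f g) (hg : Function.Surjective g)
    (a₁ : V₁ →ₗ[k] V₁) (a₂ : V₂ →ₗ[k] V₂) (a₃ : V₃ →ₗ[k] V₃) (h₁ : ∀ x, f (a₁ x) = a₂ (f x))
    (h₂ : ∀ x, g (a₂ x) = a₃ (g x)) : a₂.charpoly = a₁.charpoly * a₃.charpoly := by
  have he : LinearMap.range f ≤ (LinearMap.range f).comap a₂ := by
    rintro _ ⟨x, rfl⟩
    exact ⟨a₁ x, h₁ x⟩
  rw [charpoly_eq_restrict_mul_mapQ (LinearMap.range f) a₂ he]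
  congr 1
  · refine (charpoly_eq_of_intertwine (LinearEquiv.ofInjective f hf) _ _ fun x => ?_).symm
    exact Subtype.ext (h₁ x)
  · have hk : LinearMap.range f = LinearMap.ker g := (LinearMap.exact_iff.1 hfg).symm
    refine charpoly_eq_of_intertwine
      ((Submodule.quotEquivOfEq _ _ hk).trans (g.quotKerEquivOfSurjective hg)) _ _ fun x => ?_
    obtain ⟨y, rfl⟩ := Submodule.Quotient.mk_surjective _ x
    simp [h₂]

end Charpoly

/-! ### Generalities on `A^S`-modules -/

namespace FreeMod

section Base

variable {R : Type u} [CommRing R] {A : Type v} [Ring A] [Algebra R A]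
variable {S : Type u} [CommRing S] [Algebra R S]
variable (T : Type u) [CommRing T] [Algebra R T] [Algebra S T] [IsScalarTower R S T]

/-- The canonical map `A^S → A^T`. -/
def baseMap : S ⊗[R] A →ₐ[S] T ⊗[R] A :=
  Algebra.TensorProduct.map (Algebra.ofId S T) (AlgHom.id R A)

theorem baseMap_tmul (s : S) (a : A) :
    baseMap T (s ⊗ₜ[R] a) = algebraMap S T s ⊗ₜ[R] a := rfl

theorem baseMap_smul_tmul (V : FreeMod R A S) (b : S ⊗[R] A) (t : T) (x : V.carrier) :
    (baseMap T b • (show (extend T V).carrier from t ⊗ₜ[S] x)) =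
      (show (extend T V).carrier from t ⊗ₜ[S] (b • x)) := by
  induction b with
  | zero =>
    rw [map_zero, zero_smul, zero_smul]
    exact (TensorProduct.tmul_zero _ _).symm
  | add b c hb hc =>
    rw [map_add, add_smul, hb, hc, add_smul]
    exact (TensorProduct.tmul_add _ _ _).symm
  | tmul s a =>
    rw [baseMap_tmul]
    refine (smul_extend T V _ a t x).trans ?_
    have : (s ⊗ₜ[R] a : S ⊗[R] A) = s • ((1 : S) ⊗ₜ[R] a) := by
      rw [TensorProduct.smul_tmul', smul_eq_mul, mul_one]
    rw [this, smul_assoc]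
    change ((algebraMap S T s * t) ⊗ₜ[S] _ : T ⊗[S] V.carrier) = t ⊗ₜ[S] _
    rw [← Algebra.smul_def, TensorProduct.smul_tmul]

/-- The action of an element of `A^S` as an `S`-linear endomorphism. -/
def act (V : FreeMod R A S) : S ⊗[R] A →ₐ[S] Module.End S V.carrier := Algebra.lsmul S S V.carrier

theorem act_apply (V : FreeMod R A S) (b : S ⊗[R] A) (x : V.carrier) : V.act b x = b • x := rfl

theorem act_extend (V : FreeMod R A S) (b : S ⊗[R] A) :
    (V.extend T).act (baseMap T b) = (V.act b).baseChange T := by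
  apply LinearMap.ext
  intro x
  change T ⊗[S] V.carrier at x
  induction x with
  | zero => exact (map_zero ((V.extend T).act (baseMap T b))).trans (map_zero _).symm
  | add x y hx hy =>
    exact (map_add ((V.extend T).act (baseMap T b)) x y).trans
      ((congrArg₂ (· + ·) hx hy).trans (map_add _ _ _).symm)
  | tmul t x => exact baseMap_smul_tmul T V b t x

/-- The characteristic polynomial of the action of an element of `A^S`. -/
def chi (V : FreeMod R A S) (b : S ⊗[R] A) : Polynomial S := (V.act b).charpoly

theorem chi_extend (V : FreeMod R A S) (b : S ⊗[R] A) :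
    (V.extend T).chi (baseMap T b) = (V.chi b).map (algebraMap S T) := by
  rw [chi, act_extend, chi, ← LinearMap.charpoly_baseChange]
  rfl

theorem chi_monic (V : FreeMod R A S) (b : S ⊗[R] A) : (V.chi b).Monic :=
  LinearMap.charpoly_monic _

theorem chi_congr {V W : FreeMod R A S} (e : V.carrier ≃ₗ[S ⊗[R] A] W.carrier)
    (b : S ⊗[R] A) : V.chi b = W.chi b :=
  charpoly_eq_of_intertwine (e.restrictScalars S) _ _ fun x => e.map_smul b x

/-- The scalar extension of an isomorphism. -/
def extendEquiv {V W : FreeMod R A S} (e : V.carrier ≃ₗ[S ⊗[R] A] W.carrier) :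
    (V.extend T).carrier ≃ₗ[T ⊗[R] A] (W.extend T).carrier :=
  LinearEquiv.ofBijective (extendMap T e.toLinearMap)
    ((e.restrictScalars S).baseChange S T _ _).bijective

end Base

section Field

variable {R : Type u} [CommRing R] {A : Type v} [Ring A] [Algebra R A]
variable {k : Type u} [Field k] [Algebra R k]

theorem chi_exact {V₁ V₂ V₃ : FreeMod R A k}
    (f : V₁.carrier →ₗ[k ⊗[R] A] V₂.carrier) (g : V₂.carrier →ₗ[k ⊗[R] A] V₃.carrier)
    (hf : Function.Injective f) (hfg : Function.Exact f g) (hg : Function.Surjective g)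
    (b : k ⊗[R] A) : V₂.chi b = V₁.chi b * V₃.chi b :=
  charpoly_eq_mul_of_exact (f.restrictScalars k) (g.restrictScalars k) hf hfg hg _ _ _
    (fun x => f.map_smul b x) (fun x => g.map_smul b x)

theorem finrank_exact {V₁ V₂ V₃ : FreeMod R A k}
    (f : V₁.carrier →ₗ[k ⊗[R] A] V₂.carrier) (g : V₂.carrier →ₗ[k ⊗[R] A] V₃.carrier)
    (hf : Function.Injective f) (hfg : Function.Exact f g) (hg : Function.Surjective g) :
    Module.finrank k V₂.carrier = Module.finrank k V₁.carrier + Module.finrank k V₃.carrier := by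
  -- The dimension is the degree of any characteristic polynomial, for instance that of 0.
  have h := chi_exact f g hf hfg hg 0
  have h' := congrArg Polynomial.natDegree h
  rw [Polynomial.Monic.natDegree_mul (V₁.chi_monic _) (V₃.chi_monic _)] at h'
  simpa only [chi, LinearMap.charpoly_natDegree] using h'

/-- A submodule of a finite-dimensional `A^k`-module. -/
def sub (V : FreeMod R A k) (N : Submodule (k ⊗[R] A) V.carrier) : FreeMod R A k :=
  have : Module.Finite k N :=
    Module.Finite.of_injective (N.restrictScalars k).subtype Subtype.val_injective
  { carrier := N }

/-- A quotient of a finite-dimensional `A^k`-module. -/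
def quot (V : FreeMod R A k) (N : Submodule (k ⊗[R] A) V.carrier) : FreeMod R A k :=
  have : Module.Finite k (V.carrier ⧸ N) :=
    Module.Finite.of_surjective (N.mkQ.restrictScalars k) N.mkQ_surjective
  { carrier := V.carrier ⧸ N }

theorem exists_simple_submodule (V : FreeMod R A k) [Nontrivial V.carrier] :
    ∃ N : Submodule (k ⊗[R] A) V.carrier, IsSimpleModule (k ⊗[R] A) N := by
  have : IsArtinian (k ⊗[R] A) V.carrier := isArtinian_of_tower k inferInstance
  obtain ⟨N, hN⟩ := IsAtomic.exists_atom (Submodule (k ⊗[R] A) V.carrier)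
  exact ⟨N, isSimpleModule_iff_isAtom.2 hN⟩

/-- Induction along a composition series. -/
theorem induction {P : FreeMod R A k → Prop} (zero : ∀ V, Subsingleton V.carrier → P V)
    (step : ∀ (V₁ V₂ V₃ : FreeMod R A k) (f : V₁.carrier →ₗ[k ⊗[R] A] V₂.carrier)
      (g : V₂.carrier →ₗ[k ⊗[R] A] V₃.carrier), Function.Injective f → Function.Exact f g →
      Function.Surjective g → IsSimpleModule (k ⊗[R] A) V₁.carrier → P V₃ → P V₂)
    (V : FreeMod R A k) : P V := by
  induction hn : Module.finrank k V.carrier using Nat.strong_induction_on generalizing V with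
  | _ n ih =>
    rcases subsingleton_or_nontrivial V.carrier with h | h
    · exact zero V h
    obtain ⟨N, hN⟩ := V.exists_simple_submodule
    have hN' : IsSimpleModule (k ⊗[R] A) (V.sub N).carrier := hN
    have hex : Function.Exact N.subtype N.mkQ := LinearMap.exact_subtype_mkQ N
    refine step (V.sub N) V (V.quot N) N.subtype N.mkQ Subtype.val_injective hex
      N.mkQ_surjective hN' (ih _ ?_ _ rfl)
    have h1 := finrank_exact (V₁ := V.sub N) (V₂ := V) (V₃ := V.quot N) N.subtype N.mkQ
      Subtype.val_injective hex N.mkQ_surjective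
    have : Nontrivial (V.sub N).carrier := IsSimpleModule.nontrivial (k ⊗[R] A) N
    have h2 : 0 < Module.finrank k (V.sub N).carrier := Module.finrank_pos
    omega

end Field

end FreeMod

/-! ### Additive invariants: dimension and eigenvalue multiplicity. -/

namespace G0

variable {R : Type u} [CommRing R] {A : Type v} [Ring A] [Algebra R A]
variable {k : Type u} [Field k] [Algebra R k]

/-- The homomorphism on the Grothendieck group given by an additive function. -/
def lift {M : Type*} [AddCommGroup M] (φ : FreeMod R A k → M)
    (h : ∀ (V₁ V₂ V₃ : FreeMod R A k) (f : V₁.carrier →ₗ[k ⊗[R] A] V₂.carrier)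
      (g : V₂.carrier →ₗ[k ⊗[R] A] V₃.carrier), Function.Injective f → Function.Exact f g →
      Function.Surjective g → φ V₂ = φ V₁ + φ V₃) : G0 R A k →+ M :=
  QuotientAddGroup.lift (AddSubgroup.closure (exactRelations R A k)) (FreeAbelianGroup.lift φ) <| by
    rw [AddSubgroup.closure_le]
    rintro _ ⟨V₁, V₂, V₃, f, g, hf, hfg, hg, rfl⟩
    rw [SetLike.mem_coe, AddMonoidHom.mem_ker, map_sub, map_add, FreeAbelianGroup.lift_apply_of,
      FreeAbelianGroup.lift_apply_of, FreeAbelianGroup.lift_apply_of, sub_eq_zero]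
    exact h V₁ V₂ V₃ f g hf hfg hg

theorem lift_cls {M : Type*} [AddCommGroup M] (φ : FreeMod R A k → M) (h) (V : FreeMod R A k) :
    lift φ h (cls V) = φ V := by
  simp [lift, cls]

theorem cls_of_subsingleton (V : FreeMod R A k) (h : Subsingleton V.carrier) : cls V = 0 := by
  -- A zero module fits into an exact sequence with three copies of itself, so [V] = [V] + [V].
  have := cls_eq_add (V₁ := V) (V₂ := V) (V₃ := V) 0 0 (fun _ _ _ => Subsingleton.elim _ _)
    (fun x => ⟨fun _ => ⟨x, Subsingleton.elim _ _⟩, fun _ => rfl⟩)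
    (fun x => ⟨x, Subsingleton.elim _ _⟩)
  exact left_eq_add.1 this

theorem cls_congr {V W : FreeMod R A k} (e : V.carrier ≃ₗ[k ⊗[R] A] W.carrier) :
    cls V = cls W := by
  have hs : Subsingleton (V.quot ⊤).carrier :=
    Submodule.Quotient.subsingleton_iff.2 rfl
  have := cls_eq_add (V₁ := V) (V₂ := W) (V₃ := V.quot ⊤) e.toLinearMap 0 e.injective
    (fun x => ⟨fun _ => ⟨e.symm x, e.apply_symm_apply x⟩, fun _ => rfl⟩)
    (fun x => ⟨0, Subsingleton.elim _ _⟩)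
  rw [this, cls_of_subsingleton _ hs, add_zero]

/-- The dimension, as a homomorphism on the Grothendieck group. -/
def dim : G0 R A k →+ ℤ :=
  lift (fun V => (Module.finrank k V.carrier : ℤ)) fun _ _ _ f g hf hfg hg => by
    rw [FreeMod.finrank_exact f g hf hfg hg, Nat.cast_add]

theorem dim_cls (V : FreeMod R A k) : dim (cls V) = Module.finrank k V.carrier := lift_cls _ _ _

/-- The multiplicity of `1` as an eigenvalue of an element of `A^k`, as a homomorphism on the
Grothendieck group. -/
def eig (b : k ⊗[R] A) : G0 R A k →+ ℤ :=
  lift (fun V => ((V.chi b).rootMultiplicity 1 : ℤ)) fun V₁ _ V₃ f g hf hfg hg => by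
    rw [FreeMod.chi_exact f g hf hfg hg, Polynomial.rootMultiplicity_mul, Nat.cast_add]
    exact ((V₁.chi_monic b).mul (V₃.chi_monic b)).ne_zero

theorem eig_cls (b : k ⊗[R] A) (V : FreeMod R A k) :
    eig b (cls V) = (V.chi b).rootMultiplicity 1 := lift_cls _ _ _

end G0

/-! ### Complete systems of simple modules of split algebras -/

namespace FreeMod

section Lift

variable {R : Type u} [CommRing R] {A : Type v} [Ring A] [Algebra R A]
variable {S : Type u} [CommRing S] [Algebra R S]
variable (T : Type u) [CommRing T] [Algebra R T] [Algebra S T] [IsScalarTower R S T]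

/-- The homomorphism `T ⊗[S] M → V` of `A^T`-modules induced by a semilinear map `M → V`. -/
def extendLift (M : FreeMod R A S) (V : FreeMod R A T) (h : M.carrier →+ V.carrier)
    (hh : ∀ (b : S ⊗[R] A) x, h (b • x) = baseMap T b • h x) :
    (M.extend T).carrier →ₗ[T ⊗[R] A] V.carrier :=
  letI : Module S V.carrier := Module.compHom V.carrier (algebraMap S T)
  haveI : IsScalarTower S T V.carrier := IsScalarTower.of_algebraMap_smul fun _ _ => rfl
  let h' : M.carrier →ₗ[S] V.carrier :=
    { h with
      map_smul' := fun s x => by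
        change h (s • x) = algebraMap S T s • h x
        have h1 : s • x = (s ⊗ₜ[R] (1 : A) : S ⊗[R] A) • x := by
          rw [← algebraMap_smul (S ⊗[R] A) s x]
          rfl
        rw [h1, hh, baseMap_tmul, ← algebraMap_smul (T ⊗[R] A) (algebraMap S T s) (h x)]
        rfl }
  let q : T ⊗[S] M.carrier →ₗ[T] V.carrier := h'.liftBaseChange T
  { toFun := q
    map_add' := map_add q
    map_smul' := fun b x => by
      have hq (t : T) (x : M.carrier) : q (t ⊗ₜ x) = t • h x := LinearMap.liftBaseChange_tmul ..
      change q (extendAction T M b x) = b • q x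
      revert x
      change ∀ x : T ⊗[S] M.carrier, _
      intro x
      induction b with
      | zero => rw [map_zero, LinearMap.zero_apply, map_zero, zero_smul]
      | add b c hb hc => rw [map_add, LinearMap.add_apply, map_add, hb, hc, add_smul]
      | tmul t a =>
        induction x with
        | zero => rw [map_zero, map_zero, smul_zero]
        | add x y hx hy => rw [map_add, map_add, hx, hy, map_add, smul_add]
        | tmul t' x =>
          rw [extendAction_tmul, hq, hq, hh, baseMap_tmul, map_one,
            ← algebraMap_smul (T ⊗[R] A) (t * t'), ← algebraMap_smul (T ⊗[R] A) t', ← mul_smul,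
            ← mul_smul]
          congr 1
          rw [Algebra.TensorProduct.algebraMap_apply, Algebra.TensorProduct.algebraMap_apply,
            Algebra.TensorProduct.tmul_mul_tmul, Algebra.TensorProduct.tmul_mul_tmul]
          simp }

theorem extendLift_tmul (M : FreeMod R A S) (V : FreeMod R A T) (h : M.carrier →+ V.carrier)
    (hh) (t : T) (x : M.carrier) :
    extendLift T M V h hh (show (M.extend T).carrier from t ⊗ₜ[S] x) = t • h x := by
  let _ : Module S V.carrier := Module.compHom V.carrier (algebraMap S T)
  have : IsScalarTower S T V.carrier := IsScalarTower.of_algebraMap_smul fun _ _ => rfl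
  exact LinearMap.liftBaseChange_tmul ..

end Lift

section Field

variable {R : Type u} [CommRing R] {A : Type v} [Ring A] [Algebra R A]
variable {k : Type u} [Field k] [Algebra R k]

variable (R A k) in
/-- The regular module. -/
def regular [Module.Finite R A] : FreeMod R A k := { carrier := k ⊗[R] A }

/-- The `A^k`-module given by a representation. -/
def ofRep {M : Type (max u v)} [AddCommGroup M] [Module k M] [Module.Finite k M]
    (φ : k ⊗[R] A →ₐ[k] Module.End k M) : FreeMod R A k :=
  letI : Module (k ⊗[R] A) M := Module.compHom M φ.toRingHom
  haveI : IsScalarTower k (k ⊗[R] A) M := ⟨fun t b x => by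
    change φ (t • b) x = t • φ b x
    rw [map_smul, LinearMap.smul_apply]⟩
  { carrier := M }

end Field

end FreeMod

variable (R : Type u) [CommRing R] (A : Type v) [Ring A] [Algebra R A]

/-- A complete system of simple `A^k`-modules, together with elements of `A^k` acting as matrix
units on them. -/
structure SplitSystem (k : Type u) [Field k] [Algebra R k] where
  card : ℕ
  deg : Fin card → ℕ
  [neZero : ∀ i, NeZero (deg i)]
  mod : Fin card → FreeMod R A k
  basis : ∀ i, Module.Basis (Fin (deg i)) k (mod i).carrier
  unit : ∀ i, Fin (deg i) → Fin (deg i) → k ⊗[R] A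
  unit_smul : ∀ i r s t, unit i r s • basis i t = if s = t then basis i r else 0
  unit_smul_of_ne : ∀ i j r s t, i ≠ j → unit i r s • basis j t = 0
  complete : ∀ V : FreeMod R A k, IsSimpleModule (k ⊗[R] A) V.carrier →
    ∃ i, Nonempty ((mod i).carrier ≃ₗ[k ⊗[R] A] V.carrier)

namespace SplitSystem

attribute [instance] neZero

section

variable {R A}
variable {k : Type u} [Field k] [Algebra R k]

theorem finrank_mod (D : SplitSystem R A k) (i) :
    Module.finrank k (D.mod i).carrier = D.deg i := by
  rw [Module.finrank_eq_card_basis (D.basis i), Fintype.card_fin]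

end

end SplitSystem

/-- A non-zero vector has a non-zero coordinate, and matrix units move it to every basis vector.
Only the action on the basis matters, so the argument survives field extensions. -/
theorem isSimpleModule_of_matrix_units {k B M : Type*} [Field k] [Ring B] [Algebra k B]
    [AddCommGroup M] [Module k M] [Module B M] [IsScalarTower k B M] {n : ℕ} [NeZero n]
    (b : Module.Basis (Fin n) k M) (x : Fin n → Fin n → B)
    (hx : ∀ r s t, x r s • b t = if s = t then b r else 0) : IsSimpleModule B M := by
  have : Nontrivial M := ⟨b 0, 0, b.ne_zero 0⟩
  refine { eq_bot_or_eq_top := fun N => ?_ }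
  by_cases hN : N = ⊥
  · exact Or.inl hN
  right
  obtain ⟨v, hv, hv0⟩ := N.ne_bot_iff.1 hN
  obtain ⟨s, hs⟩ : ∃ s, b.repr v s ≠ 0 := by
    by_contra! h
    exact hv0 (b.repr.map_eq_zero_iff.1 (Finsupp.ext h))
  have hmem (c : k) {y : M} (hy : y ∈ N) : c • y ∈ N := by
    rw [← algebraMap_smul B c y]
    exact N.smul_mem _ hy
  have hr (r : Fin n) : b r ∈ N := by
    have h1 : x r s • v = b.repr v s • b r := by
      conv_lhs => rw [← b.sum_repr v]
      rw [Finset.smul_sum, Finset.sum_eq_single s]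
      · rw [smul_algebra_smul_comm, hx, if_pos rfl]
      · intro t _ ht
        rw [smul_algebra_smul_comm, hx, if_neg ht.symm, smul_zero]
      · simp
    have h2 := hmem (b.repr v s)⁻¹ (N.smul_mem (x r s) hv)
    rwa [h1, smul_smul, inv_mul_cancel₀ hs, one_smul] at h2
  refine eq_top_iff.2 fun y _ => ?_
  rw [← b.sum_repr y]
  exact N.sum_mem fun r _ => hmem _ (hr r)

namespace SplitSystem

variable {R : Type u} [CommRing R] {A : Type v} [Ring A] [Algebra R A]
variable {k : Type u} [Field k] [Algebra R k]

theorem isSimpleModule (D : SplitSystem R A k) (i) :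
    IsSimpleModule (k ⊗[R] A) (D.mod i).carrier :=
  isSimpleModule_of_matrix_units (D.basis i) (D.unit i) (D.unit_smul i)

theorem chi_unit (D : SplitSystem R A k) (i) :
    (D.mod i).chi (D.unit i 0 0) = Polynomial.X ^ D.deg i - Polynomial.X ^ (D.deg i - 1) := by
  have h : LinearMap.toMatrix (D.basis i) (D.basis i) ((D.mod i).act (D.unit i 0 0)) =
      Matrix.vecMulVec (Pi.single 0 1) (Pi.single 0 1) := by
    ext r t
    rw [LinearMap.toMatrix_apply, FreeMod.act_apply, D.unit_smul, Matrix.vecMulVec_apply]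
    by_cases ht : 0 = t
    · subst ht
      rw [if_pos rfl, Module.Basis.repr_self, Pi.single_eq_same, mul_one, Finsupp.single_apply,
        Pi.single_apply]
      exact if_congr eq_comm rfl rfl
    · rw [if_neg ht, Pi.single_eq_of_ne (Ne.symm ht), mul_zero, map_zero, Finsupp.zero_apply]
  rw [FreeMod.chi, ← LinearMap.charpoly_toMatrix _ (D.basis i), h, Matrix.charpoly_vecMulVec]
  simp

theorem chi_unit_of_ne (D : SplitSystem R A k) {i j} (hij : i ≠ j) :
    (D.mod j).chi (D.unit i 0 0) = Polynomial.X ^ D.deg j := by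
  have h : (D.mod j).act (D.unit i 0 0) = 0 :=
    (D.basis j).ext fun t => D.unit_smul_of_ne i j 0 0 t hij
  rw [FreeMod.chi, h, ← D.finrank_mod j]
  exact LinearMap.charpoly_zero

/-- The multiplicity of a simple module. -/
def mult (D : SplitSystem R A k) (i : Fin D.card) : G0 R A k →+ ℤ := G0.eig (D.unit i 0 0)

/-- A diagonal matrix unit acts as a rank one idempotent on its own module and as zero on the
others; 1 is a simple root of X^(n-1)(X-1) and no root of X^n. So the functionals `mult` are dual to
the simple classes. -/
theorem mult_mod (D : SplitSystem R A k) (i j) :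
    D.mult i (G0.cls (D.mod j)) = if i = j then 1 else 0 := by
  rw [mult, G0.eig_cls]
  by_cases hij : i = j
  · subst hij
    rw [if_pos rfl, chi_unit]
    have h : (Polynomial.X ^ D.deg i - Polynomial.X ^ (D.deg i - 1) : Polynomial k) =
        Polynomial.X ^ (D.deg i - 1) * (Polynomial.X - Polynomial.C 1) := by
      rw [mul_sub, ← pow_succ, Nat.sub_add_cancel (Nat.pos_of_ne_zero (NeZero.ne _)), map_one,
        mul_one]
    have h0 : (Polynomial.X ^ (D.deg i - 1) : Polynomial k).rootMultiplicity 1 = 0 :=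
      Polynomial.rootMultiplicity_eq_zero (by simp [Polynomial.IsRoot])
    rw [h, Polynomial.rootMultiplicity_mul (mul_ne_zero (pow_ne_zero _ Polynomial.X_ne_zero)
      (Polynomial.X_sub_C_ne_zero 1)), Polynomial.rootMultiplicity_X_sub_C_self, h0]
    rfl
  · rw [if_neg hij, chi_unit_of_ne D hij,
      Polynomial.rootMultiplicity_eq_zero (by simp [Polynomial.IsRoot])]
    rfl

theorem mult_nonneg (D : SplitSystem R A k) (i) (V : FreeMod R A k) : 0 ≤ D.mult i (G0.cls V) := by
  rw [mult, G0.eig_cls]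
  exact Int.natCast_nonneg _

theorem cls_eq_sum (D : SplitSystem R A k) (V : FreeMod R A k) :
    G0.cls V = ∑ i, D.mult i (G0.cls V) • G0.cls (D.mod i) := by
  induction V using FreeMod.induction with
  | zero V h => simp [G0.cls_of_subsingleton V h]
  | step V₁ V₂ V₃ f g hf hfg hg h₁ ih =>
    rw [G0.cls_eq_add f g hf hfg hg]
    simp_rw [map_add, add_smul]
    rw [Finset.sum_add_distrib, ← ih]
    congr 1
    obtain ⟨j, ⟨e⟩⟩ := D.complete V₁ h₁
    rw [← G0.cls_congr e]
    simp [mult_mod]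

theorem g0_hom_ext {M : Type*} [AddCommGroup M] {φ ψ : G0 R A k →+ M}
    (h : ∀ V, φ (G0.cls V) = ψ (G0.cls V)) : φ = ψ := by
  ext V
  exact h V

theorem eq_sum (D : SplitSystem R A k) (x : G0 R A k) :
    x = ∑ i, D.mult i x • G0.cls (D.mod i) := by
  let φ : G0 R A k →+ G0 R A k :=
    { toFun := fun x => ∑ i, D.mult i x • G0.cls (D.mod i)
      map_zero' := by simp
      map_add' := fun x y => by simp only [map_add, add_smul, Finset.sum_add_distrib] }
  have h : AddMonoidHom.id (G0 R A k) = φ := g0_hom_ext D.cls_eq_sum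
  exact DFunLike.congr_fun h x

/-- Identities in the Grothendieck group thus reduce to comparing eigenvalue multiplicities of
finitely many fixed elements. -/
theorem ext_mult (D : SplitSystem R A k) {x y : G0 R A k} (h : ∀ i, D.mult i x = D.mult i y) :
    x = y := by
  rw [D.eq_sum x, D.eq_sum y]
  simp_rw [h]

theorem cls_mod_injective (D : SplitSystem R A k) :
    Function.Injective fun i => G0.cls (D.mod i) := by
  intro i j h
  have := congrArg (D.mult i) h
  simp only [mult_mod, if_true] at this
  by_contra hij
  rw [if_neg hij] at this
  exact one_ne_zero this

theorem simpleClasses_eq (D : SplitSystem R A k) :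
    simpleClasses R A k = Set.range fun i => G0.cls (D.mod i) := by
  ext x
  constructor
  · rintro ⟨V, hV, rfl⟩
    obtain ⟨i, ⟨e⟩⟩ := D.complete V hV
    exact ⟨i, G0.cls_congr e⟩
  · rintro ⟨i, rfl⟩
    exact ⟨D.mod i, D.isSimpleModule i, rfl⟩

/-! #### Existence -/

/-- The simple modules are the column spaces of the matrix factors of the semisimple quotient; the
matrix units are preimages under ρ. -/
theorem exists_of_isSplit [Module.Finite R A] (h : IsSplit k (k ⊗[R] A)) :
    ∃ D : SplitSystem R A k, ∑ i, D.deg i ^ 2 = radRank k (k ⊗[R] A) := by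
  obtain ⟨m, n, ρ, hn, hρ, hker⟩ := h.exists_surjective_pi_matrix
  -- `ULift` only places the column space in the universe of carriers of `FreeMod`.
  let b (i : Fin m) : Module.Basis (Fin (n i)) k (ULift.{max u v} (Fin (n i) → k)) :=
    (Pi.basisFun k (Fin (n i))).map ULift.moduleEquiv.symm
  let φ (i : Fin m) : k ⊗[R] A →ₐ[k] Module.End k (ULift.{max u v} (Fin (n i) → k)) :=
    ((Matrix.toLinAlgEquiv (b i) : _ →ₐ[k] _).comp (Pi.evalAlgHom k _ i)).comp ρ
  have hφ (i : Fin m) (x : k ⊗[R] A) (t : Fin (n i)) :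
      φ i x (b i t) = ∑ r, ρ x i r t • b i r := Matrix.toLinAlgEquiv_self _ _ _
  choose x hx using fun (i : Fin m) (r s : Fin (n i)) =>
    hρ (Pi.single i (Matrix.single r s (1 : k)))
  have hxs (i : Fin m) (r s t : Fin (n i)) :
      φ i (x i r s) (b i t) = if s = t then b i r else 0 := by
    rw [hφ, hx, Pi.single_eq_same]
    by_cases hst : s = t
    · subst hst
      rw [if_pos rfl, Finset.sum_eq_single r]
      · rw [Matrix.single_apply_same, one_smul]
      · intro r' _ hr'
        rw [Matrix.single_apply_of_row_ne (Ne.symm hr'), zero_smul]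
      · simp
    · rw [if_neg hst]
      refine Finset.sum_eq_zero fun r' _ => ?_
      rw [Matrix.single_apply_of_col_ne _ _ hst, zero_smul]
  refine ⟨⟨m, n, fun i => FreeMod.ofRep (φ i), b, x, hxs, ?_, ?_⟩, ?_⟩
  · intro i j r s t hij
    change φ j (x i r s) (b j t) = 0
    rw [hφ, hx, Pi.single_eq_of_ne (Ne.symm hij)]
    simp
  · intro V hV
    -- The radical annihilates the simple module V, so the action on V factors through ρ.
    have hkill (y : k ⊗[R] A) (hy : ρ y = 0) (v : V.carrier) : y • v = 0 :=
      Module.mem_annihilator.1 (IsSemisimpleModule.jacobson_le_annihilator (k ⊗[R] A) V.carrier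
        (hker ▸ (hy : y ∈ RingHom.ker ρ))) v
    have hcong {y z : k ⊗[R] A} (hyz : ρ y = ρ z) (v : V.carrier) : y • v = z • v := by
      rw [← sub_eq_zero, ← sub_smul]
      exact hkill _ (by rw [map_sub, hyz, sub_self]) v
    have : Nontrivial V.carrier := IsSimpleModule.nontrivial (k ⊗[R] A) V.carrier
    obtain ⟨v, hv⟩ := exists_ne (0 : V.carrier)
    -- The diagonal units sum to 1 modulo the radical, so they cannot all kill v.
    obtain ⟨i, s, his⟩ : ∃ i s, x i s s • v ≠ 0 := by
      by_contra! hall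
      apply hv
      have h1 : ρ (∑ i, ∑ s, x i s s) = ρ 1 := by
        rw [map_one]
        simp_rw [map_sum, hx]
        ext i : 1
        rw [Finset.sum_apply, Finset.sum_eq_single i]
        · simp only [Finset.sum_apply, Pi.single_eq_same]
          ext r t
          change _ = (1 : Matrix (Fin (n i)) (Fin (n i)) k) r t
          rw [Matrix.sum_apply, Matrix.one_apply]
          simp_rw [Matrix.single_apply]
          by_cases hrt : r = t
          · subst hrt
            simp
          · rw [if_neg hrt]
            exact Finset.sum_eq_zero fun s _ => if_neg fun h' => hrt (h'.1.symm.trans h'.2)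
        · intro j _ hj
          simp [Pi.single_eq_of_ne hj.symm]
        · simp
      rw [← one_smul (k ⊗[R] A) v, ← hcong h1 v, Finset.sum_smul]
      refine Finset.sum_eq_zero fun i _ => ?_
      rw [Finset.sum_smul]
      exact Finset.sum_eq_zero fun s _ => hall i s
    -- Sending the t-th column vector to E_ts v gives a map of simple modules that is non-zero at t
    -- = s, hence an isomorphism by Schur's lemma.
    let g : ULift.{max u v} (Fin (n i) → k) →ₗ[k] V.carrier :=
      (b i).constr k fun t => x i t s • v
    have hg (t) : g (b i t) = x i t s • v := (b i).constr_basis ..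
    let W : FreeMod R A k := FreeMod.ofRep (φ i)
    let bW : Module.Basis (Fin (n i)) k W.carrier := b i
    have hW : IsSimpleModule (k ⊗[R] A) W.carrier :=
      isSimpleModule_of_matrix_units bW (x i) (hxs i)
    let G : W.carrier →ₗ[k ⊗[R] A] V.carrier :=
      { toFun := g
        map_add' := map_add g
        map_smul' := fun y w => by
          change g (φ i y w) = y • g w
          have : g ∘ₗ φ i y = V.act y ∘ₗ g := by
            refine (b i).ext fun t => ?_
            rw [LinearMap.comp_apply, LinearMap.comp_apply, hφ, map_sum, hg, FreeMod.act_apply,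
              ← mul_smul]
            simp_rw [map_smul, hg, ← smul_assoc]
            rw [← Finset.sum_smul]
            refine hcong ?_ v
            rw [map_sum, map_mul, hx]
            simp_rw [map_smul, hx]
            ext j : 1
            by_cases hij : j = i
            · subst hij
              ext p q
              simp [Finset.sum_apply, Matrix.sum_apply, Matrix.single_apply, Matrix.mul_apply, ite_and]
            · simp [Finset.sum_apply, Pi.single_eq_of_ne hij]
          exact DFunLike.congr_fun this w }
    refine ⟨i, ⟨LinearEquiv.ofBijective G (LinearMap.bijective_of_ne_zero fun h0 => ?_)⟩⟩
    apply his
    rw [← hg]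
    exact DFunLike.congr_fun h0 (b i s)
  · rw [finrank_eq_of_surjective k ρ hρ hker, finrank_pi_matrix]

/-! #### Base change -/

section BaseChange

variable (L : Type u) [Field L] [Algebra R L] [Algebra k L] [IsScalarTower R k L]

/-- The basis of a scalar extension. -/
def extendBasis (D : SplitSystem R A k) (i) :
    Module.Basis (Fin (D.deg i)) L ((D.mod i).extend L).carrier :=
  (D.basis i).baseChange L

theorem extendBasis_apply (D : SplitSystem R A k) (i t) :
    D.extendBasis L i t = (show ((D.mod i).extend L).carrier from 1 ⊗ₜ[k] D.basis i t) :=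
  Module.Basis.baseChange_apply ..

theorem baseMap_unit_smul (D : SplitSystem R A k) (i r s t) :
    FreeMod.baseMap L (D.unit i r s) • D.extendBasis L i t =
      if s = t then D.extendBasis L i r else 0 := by
  rw [extendBasis_apply, FreeMod.baseMap_smul_tmul, D.unit_smul]
  split_ifs
  · rw [extendBasis_apply]
  · exact TensorProduct.tmul_zero _ _

theorem baseMap_unit_smul_of_ne (D : SplitSystem R A k) (i j r s t) (hij : i ≠ j) :
    FreeMod.baseMap L (D.unit i r s) • D.extendBasis L j t = 0 := by
  rw [extendBasis_apply, FreeMod.baseMap_smul_tmul, D.unit_smul_of_ne _ _ _ _ _ hij]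
  exact TensorProduct.tmul_zero _ _

theorem isSimpleModule_extend (D : SplitSystem R A k) (i) :
    IsSimpleModule (L ⊗[R] A) ((D.mod i).extend L).carrier :=
  isSimpleModule_of_matrix_units (D.extendBasis L i) _ (D.baseMap_unit_smul L i)

/-- A simple module that is a quotient of a scalar extension is the scalar extension of a simple
module. -/
theorem exists_equiv_of_extend (D : SplitSystem R A k) (V : FreeMod R A L)
    (hV : IsSimpleModule (L ⊗[R] A) V.carrier) (M : FreeMod R A k) :
    ∀ q : (M.extend L).carrier →ₗ[L ⊗[R] A] V.carrier, q ≠ 0 →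
      ∃ i, Nonempty (((D.mod i).extend L).carrier ≃ₗ[L ⊗[R] A] V.carrier) := by
  induction M using FreeMod.induction with
  | zero M h =>
    intro q hq
    have : Subsingleton (M.extend L).carrier := inferInstanceAs (Subsingleton (L ⊗[k] M.carrier))
    exact absurd (LinearMap.ext fun x => by
      rw [Subsingleton.elim x 0, map_zero, map_zero]) hq
  | step V₁ V₂ V₃ f g hf hfg hg h₁ ih =>
    intro q hq
    obtain ⟨j, ⟨e⟩⟩ := D.complete V₁ h₁
    -- Either q factors through the extension of V₃ and induction applies, or it is non-zero on the
    -- extension of the simple module V₁, which stays simple, and Schur's lemma applies.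
    by_cases h0 : q ∘ₗ FreeMod.extendMap L f = 0
    · let g' := FreeMod.extendMap L g
      have hg' : Function.Surjective g' := LinearMap.lTensor_surjective L (g := g.restrictScalars k) hg
      have hker : LinearMap.ker g' ≤ LinearMap.ker q := by
        intro x hx
        have hex : Function.Exact (FreeMod.extendMap L f) g' :=
          Module.Flat.lTensor_exact (M := L) (f := f.restrictScalars k)
            (g := g.restrictScalars k) hfg
        obtain ⟨y, rfl⟩ := (hex x).1 hx
        exact DFunLike.congr_fun h0 y
      refine ih ((LinearMap.ker g').liftQ q hker ∘ₗ
        (g'.quotKerEquivOfSurjective hg').symm.toLinearMap) fun h => hq (LinearMap.ext fun x => ?_)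
      have := DFunLike.congr_fun h (g' x)
      have hs : (g'.quotKerEquivOfSurjective hg').symm (g' x) = Submodule.Quotient.mk x := by
        rw [LinearEquiv.symm_apply_eq]
        rfl
      rw [LinearMap.comp_apply, LinearEquiv.coe_coe, hs] at this
      exact this
    · have := D.isSimpleModule_extend L j
      let q' := q ∘ₗ FreeMod.extendMap L f ∘ₗ (FreeMod.extendEquiv L e).toLinearMap
      have hq' : q' ≠ 0 := fun h => h0 (LinearMap.ext fun x => by
        have := DFunLike.congr_fun h ((FreeMod.extendEquiv L e).symm x)
        simpa [q'] using this)
      exact ⟨j, ⟨LinearEquiv.ofBijective q' (LinearMap.bijective_of_ne_zero hq')⟩⟩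

/-- The scalar extension of a complete system of simple modules. -/
def extend [Module.Finite R A] (D : SplitSystem R A k) : SplitSystem R A L where
  card := D.card
  deg := D.deg
  mod i := (D.mod i).extend L
  basis := D.extendBasis L
  unit i r s := FreeMod.baseMap L (D.unit i r s)
  unit_smul := D.baseMap_unit_smul L
  unit_smul_of_ne := D.baseMap_unit_smul_of_ne L
  complete V hV := by
    have := IsSimpleModule.nontrivial (L ⊗[R] A) V.carrier
    obtain ⟨v, hv⟩ := exists_ne (0 : V.carrier)
    -- The orbit map of v extends to L ⊗ A^k and sends 1 to v, so V receives a non-zero map from a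
    -- scalar extension.
    let h : (FreeMod.regular R A k).carrier →+ V.carrier :=
      (AddMonoidHom.flip (smulAddHom (L ⊗[R] A) V.carrier) v).comp
        (FreeMod.baseMap L : k ⊗[R] A →ₐ[k] L ⊗[R] A).toRingHom.toAddMonoidHom
    have hh (b : k ⊗[R] A) : h b = FreeMod.baseMap L b • v := rfl
    have hb (b : k ⊗[R] A) (x : (FreeMod.regular R A k).carrier) :
        h (b • x) = FreeMod.baseMap L b • h x :=
      (congrArg (· • v) (map_mul (FreeMod.baseMap L) b x)).trans (mul_smul _ _ v)
    refine D.exists_equiv_of_extend L V hV (FreeMod.regular R A k)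
      (FreeMod.extendLift L _ V h hb) fun h0 => hv ?_
    have h1 := FreeMod.extendLift_tmul L (FreeMod.regular R A k) V h hb 1 (1 : k ⊗[R] A)
    rw [h0, one_smul, hh, map_one, one_smul] at h1
    exact h1.symm

/-- Root multiplicities are unchanged under an extension of fields. -/
theorem mult_extend [Module.Finite R A] (D : SplitSystem R A k) (i : Fin D.card) (x : G0 R A k) :
    (D.extend L).mult i (G0.extend R A k L x) = D.mult i x := by
  have : ((D.extend L).mult i).comp (G0.extend R A k L) = D.mult i := g0_hom_ext fun V => by
    rw [AddMonoidHom.comp_apply, G0.extend_cls]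
    unfold mult
    rw [G0.eig_cls, G0.eig_cls]
    change (((V.extend L).chi (FreeMod.baseMap L (D.unit i 0 0))).rootMultiplicity 1 : ℤ) = _
    rw [FreeMod.chi_extend, ← map_one (algebraMap k L),
      Polynomial.eq_rootMultiplicity_map (algebraMap k L).injective]
  exact DFunLike.congr_fun this x

theorem extend_surjective [Module.Finite R A] (D : SplitSystem R A k) :
    Function.Surjective (G0.extend R A k L) := fun y => by
  refine ⟨∑ i, (D.extend L).mult i y • G0.cls (D.mod i), ?_⟩
  rw [map_sum]
  simp_rw [map_zsmul, G0.extend_cls]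
  exact ((D.extend L).eq_sum y).symm

end BaseChange

end SplitSystem

/-! ### Existence of gates -/

/-- Over a valuation ring every finite-dimensional module over the generic fibre has a form. -/
theorem FreeMod.exists_form {R : Type u} [CommRing R] {A : Type v} [Ring A] [Algebra R A]
    [Module.Finite R A] {S K : Type u} [CommRing S] [IsDomain S] [ValuationRing S] [Field K]
    [Algebra S K] [IsFractionRing S K] [Algebra R S] [Algebra R K] [IsScalarTower R S K]
    (V : FreeMod R A K) :
    ∃ W : FreeMod R A S, Nonempty ((W.extend K).carrier ≃ₗ[K ⊗[R] A] V.carrier) := by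
  let _ : Module (S ⊗[R] A) V.carrier :=
    Module.compHom V.carrier (FreeMod.baseMap K :
      S ⊗[R] A →ₐ[S] K ⊗[R] A).toRingHom
  let _ : Module S V.carrier := Module.compHom V.carrier (algebraMap S K)
  have hO : IsScalarTower S K V.carrier :=
    IsScalarTower.of_algebraMap_smul fun _ _ => rfl
  have hsmul (b : S ⊗[R] A) (x : V.carrier) :
      b • x = FreeMod.baseMap K b • x := rfl
  have htower : IsScalarTower S (S ⊗[R] A) V.carrier := ⟨fun s b x => by
    rw [hsmul, hsmul, map_smul, ← algebraMap_smul K s (FreeMod.baseMap _ b),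
      smul_assoc]
    rfl⟩
  let b := Module.Free.chooseBasis K V.carrier
  -- The lattice spanned over A^S by a K-basis; it is finitely generated over S because A is finite
  -- over R.
  let N : Submodule (S ⊗[R] A) V.carrier := Submodule.span _ (Set.range b)
  have hfin' : Module.Finite (S ⊗[R] A) N :=
    Module.Finite.iff_fg.2 (Submodule.fg_span (Set.finite_range b))
  have hfin : Module.Finite S N := Module.Finite.trans (S ⊗[R] A) N
  have htf : Module.IsTorsionFree S V.carrier :=
    Module.IsTorsionFree.trans_faithfulSMul S K V.carrier
  have htfN : Module.IsTorsionFree S N := inferInstance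
  -- A valuation ring is Bézout, so torsion-free means flat; over a local ring, finite and flat
  -- means free.
  have hflat : Module.Flat S N :=
    (Module.Flat.flat_iff_torsion_eq_bot_of_isBezout (R := S) (M := N)).2
      (Submodule.isTorsionFree_iff_torsion_eq_bot.1 htfN)
  have hfree : Module.Free S N := Module.free_of_flat_of_isLocalRing
  let W : FreeMod R A S := { carrier := N }
  let g := FreeMod.extendLift K W V N.subtype.toAddMonoidHom fun _ _ => rfl
  have hg (t : K) (x : N) :
      g (show (W.extend K).carrier from t ⊗ₜ[S] x) = t • x.1 :=
    FreeMod.extendLift_tmul ..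
  refine ⟨W, ⟨LinearEquiv.ofBijective g ⟨?_, ?_⟩⟩⟩
  · let c := Module.Free.chooseBasis S N
    let c' : Module.Basis _ K (W.extend K).carrier :=
      c.baseChange K
    have hc' (i) : (g.restrictScalars K) (c' i) = (c i).1 := by
      have : c' i = (show (W.extend K).carrier from 1 ⊗ₜ[S] c i) :=
        Module.Basis.baseChange_apply ..
      rw [this]
      exact (hg 1 (c i)).trans (one_smul _ _)
    -- An S-basis of the lattice stays independent over the fraction field, which makes the
    -- comparison map injective.
    have hli : LinearIndependent K fun i => (c i).1 := by
      rw [← LinearIndependent.iff_fractionRing S]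
      exact c.linearIndependent.map' (N.subtype.restrictScalars S)
        (LinearMap.ker_eq_bot.2 Subtype.val_injective)
    change Function.Injective (g.restrictScalars K)
    exact LinearMap.injective_of_linearIndependent (v := c') c'.span_eq
      (by simpa only [Function.comp_def, hc'] using hli)
  · change Function.Surjective (g.restrictScalars K)
    rw [← LinearMap.range_eq_top, eq_top_iff, ← b.span_eq, Submodule.span_le]
    rintro _ ⟨i, rfl⟩
    exact ⟨_, (hg 1 ⟨b i, Submodule.subset_span ⟨i, rfl⟩⟩).trans (one_smul _ _)⟩

namespace LocalOver

variable {R : Type u} [CommRing R] {p : PrimeSpectrum R} (O : LocalOver p)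

theorem isFractionRing [IsDomain R] : IsFractionRing O.ring (FractionRing R) where
  map_units y := isUnit_iff_ne_zero.2 fun h => nonZeroDivisors.ne_zero y.2 (Subtype.ext h)
  surj z := by
    obtain ⟨a, b, hb, rfl⟩ := IsFractionRing.div_surjective (A := R) z
    have hb' : algebraMap R (FractionRing R) b ≠ 0 :=
      IsFractionRing.to_map_ne_zero_of_mem_nonZeroDivisors hb
    have hb0 : algebraMap R O.ring b ≠ 0 := fun h => hb' (congrArg Subtype.val h)
    exact ⟨⟨algebraMap R O.ring a, ⟨_, mem_nonZeroDivisors_of_ne_zero hb0⟩⟩,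
      div_mul_cancel₀ _ hb'⟩
  exists_of_eq h := ⟨1, by rw [Subtype.ext h]⟩

/-- The local ring R_𝔭 inside K is dominated by a valuation ring of K. -/
theorem exists_valuation [IsDomain R] (p : PrimeSpectrum R) :
    ∃ O : LocalOver p, ∀ x : FractionRing R, x ∈ O.ring ∨ x⁻¹ ∈ O.ring := by
  let f : Localization.AtPrime p.asIdeal →+* FractionRing R :=
    IsLocalization.lift (M := p.asIdeal.primeCompl) (g := algebraMap R (FractionRing R)) fun y =>
      isUnit_iff_ne_zero.2 (IsFractionRing.to_map_ne_zero_of_mem_nonZeroDivisors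
        (p.asIdeal.primeCompl_le_nonZeroDivisors y.2))
  have hf (r : R) : f (algebraMap R _ r) = algebraMap R (FractionRing R) r :=
    IsLocalization.lift_eq _ r
  obtain ⟨B, hB, hloc⟩ := IsLocalRing.exists_factor_valuationRing f
  let S : Subalgebra R (FractionRing R) :=
    { B.toSubring with algebraMap_mem' := fun r => hf r ▸ hB (algebraMap R _ r) }
  let e : B.toSubring ≃+* S :=
    { toFun := fun x => ⟨x.1, x.2⟩, invFun := fun x => ⟨x.1, x.2⟩, map_mul' := fun _ _ => rfl,
      map_add' := fun _ _ => rfl }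
  have hlocal : IsLocalRing B.toSubring := B.isLocalRing
  have : IsLocalRing S := e.isLocalRing
  refine ⟨⟨S, ?_⟩, fun x => B.mem_or_inv_mem x⟩
  -- By domination, r is a unit in the valuation ring iff it is one in R_𝔭, that is, iff r is not in
  -- 𝔭.
  ext r
  rw [Ideal.mem_comap, IsLocalRing.mem_maximalIdeal, mem_nonunits_iff, not_iff_comm,
    show algebraMap R S r = e (f.codRestrict B.toSubring hB (algebraMap R _ r)) from
      Subtype.ext (hf r).symm, MulEquiv.isUnit_map, isUnit_map_iff,
    IsLocalization.AtPrime.isUnit_to_map_iff _ p.asIdeal]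
  rfl

theorem isWeakGate_of_valuation [IsDomain R] (A : Type v) [Ring A] [Algebra R A]
    [Module.Finite R A] (h : ∀ x : FractionRing R, x ∈ O.ring ∨ x⁻¹ ∈ O.ring) :
    O.IsWeakGate A := by
  intro V
  have hfrac := O.isFractionRing
  have : ValuationRing O.ring :=
    (ValuationRing.iff_isInteger_or_isInteger O.ring (FractionRing R)).2 fun x =>
      (h x).imp (fun hx => ⟨⟨x, hx⟩, rfl⟩) fun hx => ⟨⟨_, hx⟩, rfl⟩
  exact FreeMod.exists_form V

variable (A : Type v) [Ring A] [Algebra R A] [Module.Finite R A]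

/-- All classes over k(𝔪) come from k(𝔭), since the simple modules of the split fibre extend to a
complete system. -/
theorem isGate_of_isWeakGate (D : SplitSystem R A p.asIdeal.ResidueField)
    (h : O.IsWeakGate A) : O.IsGate A :=
  ⟨h, fun W => D.extend_surjective O.kappa (G0.cls (W.extend O.kappa))⟩

end LocalOver

/-! ### Decomposition matrices -/

section Matrices

variable {ι ι' : Type*} [Fintype ι] {n : ι → ℕ} {m : ι' → ℕ} {d : ι → ι' → ℕ}

theorem sum_sq_le_sq_sum {ι : Type*} [Fintype ι] (x : ι → ℕ) :
    ∑ j, x j ^ 2 ≤ (∑ j, x j) ^ 2 := by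
  rw [sq, Finset.sum_mul]
  refine Finset.sum_le_sum fun j _ => ?_
  rw [sq]
  exact Nat.mul_le_mul_left _ (Finset.single_le_sum (fun _ _ => Nat.zero_le _) (Finset.mem_univ j))

theorem sum_sq_column_le (hcol : ∀ j, ∃ i, d i j ≠ 0) (j : ι') :
    m j ^ 2 ≤ ∑ i, (d i j * m j) ^ 2 := by
  obtain ⟨i, hi⟩ := hcol j
  refine le_trans ?_ (Finset.single_le_sum (f := fun i => (d i j * m j) ^ 2)
    (fun _ _ => Nat.zero_le _) (Finset.mem_univ i))
  exact Nat.pow_le_pow_left (Nat.le_mul_of_pos_left _ (Nat.pos_of_ne_zero hi)) 2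

variable [Fintype ι']

/-- Non-zero columns bound each m j ^ 2 by the column sum of (d i j * m j) ^ 2; in each row the sum
of squares is at most the square of the sum. -/
theorem sum_sq_le_of_decomposition (hcol : ∀ j, ∃ i, d i j ≠ 0)
    (hrow : ∀ i, n i = ∑ j, d i j * m j) : ∑ j, m j ^ 2 ≤ ∑ i, n i ^ 2 :=
  calc ∑ j, m j ^ 2 ≤ ∑ j, ∑ i, (d i j * m j) ^ 2 :=
        Finset.sum_le_sum fun j _ => sum_sq_column_le hcol j
    _ = ∑ i, ∑ j, (d i j * m j) ^ 2 := Finset.sum_comm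
    _ ≤ ∑ i, n i ^ 2 := Finset.sum_le_sum fun i _ => hrow i ▸ sum_sq_le_sq_sum _

/-- Equality of the totals forces equality in every row and every column: a row then has a single
non-zero entry, and the squares of the entries in a column sum to 1. -/
theorem exists_bijective_of_decomposition [DecidableEq ι'] (hn : ∀ i, n i ≠ 0) (hm : ∀ j, m j ≠ 0)
    (hcol : ∀ j, ∃ i, d i j ≠ 0) (hrow : ∀ i, n i = ∑ j, d i j * m j)
    (h : ∑ j, m j ^ 2 = ∑ i, n i ^ 2) :
    ∃ π : ι → ι', Function.Bijective π ∧ ∀ i j, d i j = if π i = j then 1 else 0 := by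
  have h1 (i) : ∑ j, (d i j * m j) ^ 2 ≤ n i ^ 2 := hrow i ▸ sum_sq_le_sq_sum _
  have hcomm : ∑ j, ∑ i, (d i j * m j) ^ 2 = ∑ i, ∑ j, (d i j * m j) ^ 2 := Finset.sum_comm
  have hle1 := Finset.sum_le_sum fun j (_ : j ∈ Finset.univ) => sum_sq_column_le (m := m) hcol j
  have hle2 := Finset.sum_le_sum fun i (_ : i ∈ Finset.univ) => h1 i
  have hcoleq (j) : m j ^ 2 = ∑ i, (d i j * m j) ^ 2 :=
    (Finset.sum_eq_sum_iff_of_le fun j _ => sum_sq_column_le hcol j).1 (by omega) j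
      (Finset.mem_univ j)
  have hroweq (i) : ∑ j, (d i j * m j) ^ 2 = n i ^ 2 :=
    (Finset.sum_eq_sum_iff_of_le fun i _ => h1 i).1 (by omega) i (Finset.mem_univ i)
  have hxle (i j) : d i j * m j ≤ n i :=
    hrow i ▸ Finset.single_le_sum (f := fun j => d i j * m j) (fun _ _ => Nat.zero_le _)
      (Finset.mem_univ j)
  -- The entries x j = d i j * m j are at most n i and ∑ x j ^ 2 = ∑ x j * n i, so every non-zero x
  -- j equals n i.
  have hx (i j) (hij : d i j ≠ 0) : d i j * m j = n i := by
    have h2 : ∑ j, (d i j * m j) ^ 2 = ∑ j, d i j * m j * n i := by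
      rw [hroweq, ← Finset.sum_mul, ← hrow, sq]
    have h3 := (Finset.sum_eq_sum_iff_of_le fun j _ => by
      rw [sq]; exact Nat.mul_le_mul_left _ (hxle i j)).1 h2 j (Finset.mem_univ j)
    rw [sq] at h3
    exact Nat.eq_of_mul_eq_mul_left (Nat.pos_of_ne_zero (mul_ne_zero hij (hm j))) h3
  have hcol1 (j) : ∑ i, d i j ^ 2 = 1 := by
    have h2 := hcoleq j
    simp_rw [mul_pow] at h2
    rw [← Finset.sum_mul] at h2
    exact Nat.eq_of_mul_eq_mul_right (pow_pos (Nat.pos_of_ne_zero (hm j)) 2) (by omega)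
  have hex (i) : ∃ j, d i j ≠ 0 := by
    by_contra! h0
    exact hn i (by rw [hrow]; simp [h0])
  choose π hπ using hex
  have huniq (i j) (hij : d i j ≠ 0) : π i = j := by
    by_contra hne
    have h2 : d i (π i) * m (π i) + d i j * m j ≤ n i := by
      rw [hrow i, ← Finset.sum_pair (f := fun j => d i j * m j) hne]
      exact Finset.sum_le_sum_of_subset (Finset.subset_univ _)
    rw [hx i _ (hπ i), hx i j hij] at h2
    have := hn i
    omega
  have hone (i j) (hij : d i j ≠ 0) : d i j = 1 := by
    have h2 : d i j ^ 2 ≤ 1 := hcol1 j ▸ Finset.single_le_sum (f := fun i => d i j ^ 2)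
      (fun _ _ => Nat.zero_le _) (Finset.mem_univ i)
    have h3 : d i j ≤ 1 := by nlinarith
    omega
  refine ⟨π, ⟨fun i i' hii => ?_, fun j => ?_⟩, fun i j => ?_⟩
  · classical
    by_contra hne
    have h2 : d i (π i) ^ 2 + d i' (π i) ^ 2 ≤ 1 := by
      rw [← hcol1 (π i), ← Finset.sum_pair (f := fun l => d l (π i) ^ 2) hne]
      exact Finset.sum_le_sum_of_subset (Finset.subset_univ _)
    rw [hone i _ (hπ i), hone i' _ (hii ▸ hπ i')] at h2
    omega
  · obtain ⟨i, hi⟩ := hcol j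
    exact ⟨i, huniq i j hi⟩
  · split_ifs with hij
    · exact hone i j (hij ▸ hπ i)
    · by_contra h0
      exact hij (huniq i j h0)

end Matrices

/-! ### The decomposition map -/

theorem FreeMod.baseMap_surjective {R : Type u} [CommRing R] {A : Type v} [Ring A] [Algebra R A]
    {S T : Type u} [CommRing S] [Algebra R S] [CommRing T] [Algebra R T] [Algebra S T]
    [IsScalarTower R S T] (h : Function.Surjective (algebraMap S T)) :
    Function.Surjective (FreeMod.baseMap T : S ⊗[R] A →ₐ[S] T ⊗[R] A) :=
  TensorProduct.map_surjective (g := (IsScalarTower.toAlgHom R S T).toLinearMap)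
    (g' := (LinearMap.id : A →ₗ[R] A)) h Function.surjective_id

theorem FreeMod.finrank_extend {R : Type u} [CommRing R] {A : Type v} [Ring A] [Algebra R A]
    {S T : Type u} [CommRing S] [Algebra R S] [CommRing T] [Nontrivial T] [Algebra R T]
    [Algebra S T] [IsScalarTower R S T] (W : FreeMod R A S) :
    Module.finrank T (W.extend T).carrier = Module.finrank S W.carrier :=
  have : Nontrivial S := (algebraMap S T).domain_nontrivial
  Module.finrank_baseChange

theorem G0.dim_extend {R : Type u} [CommRing R] {A : Type v} [Ring A] [Algebra R A]
    {k L : Type u} [Field k] [Algebra R k] [Field L] [Algebra R L] [Algebra k L]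
    [IsScalarTower R k L] (x : G0 R A k) : G0.dim (G0.extend R A k L x) = G0.dim x := by
  have : G0.dim.comp (G0.extend R A k L) = G0.dim := SplitSystem.g0_hom_ext fun V => by
    rw [AddMonoidHom.comp_apply, G0.extend_cls, G0.dim_cls, G0.dim_cls, FreeMod.finrank_extend]
  exact DFunLike.congr_fun this x

theorem SplitSystem.extend_injective {R : Type u} [CommRing R] {A : Type v} [Ring A] [Algebra R A]
    [Module.Finite R A] {k : Type u} [Field k] [Algebra R k] (D : SplitSystem R A k) (L : Type u)
    [Field L] [Algebra R L] [Algebra k L] [IsScalarTower R k L] :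
    Function.Injective (G0.extend R A k L) := fun x y h =>
  D.ext_mult fun i => by rw [← D.mult_extend L, ← D.mult_extend L, h]

namespace LocalOver

variable {R : Type u} [CommRing R] [IsDomain R] {p : PrimeSpectrum R} (O : LocalOver p)
variable {A : Type v} [Ring A] [Algebra R A]

theorem chi_form {W : FreeMod R A O.ring} {V : FreeMod R A (FractionRing R)}
    (e : Nonempty ((W.extend (FractionRing R)).carrier ≃ₗ[FractionRing R ⊗[R] A] V.carrier))
    (a : O.ring ⊗[R] A) : (W.chi a).map (algebraMap O.ring (FractionRing R)) =
      V.chi (FreeMod.baseMap (FractionRing R) a) := by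
  obtain ⟨e⟩ := e
  rw [← FreeMod.chi_extend, FreeMod.chi_congr e]

theorem finrank_form {W : FreeMod R A O.ring} {V : FreeMod R A (FractionRing R)}
    (e : Nonempty ((W.extend (FractionRing R)).carrier ≃ₗ[FractionRing R ⊗[R] A] V.carrier)) :
    Module.finrank O.kappa (W.extend O.kappa).carrier =
      Module.finrank (FractionRing R) V.carrier := by
  obtain ⟨e⟩ := e
  rw [FreeMod.finrank_extend, ← (e.restrictScalars (FractionRing R)).finrank_eq,
    FreeMod.finrank_extend]

variable [Module.Finite R A] (D : SplitSystem R A p.asIdeal.ResidueField)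

/-- The element a is any lift of the matrix unit along the surjection 𝒪 → k(𝔪); it need not be
idempotent, since only its characteristic polynomial on W is used. -/
theorem mult_reduction (j : Fin D.card) : ∃ a : O.ring ⊗[R] A, ∀ W : FreeMod R A O.ring,
    (D.extend O.kappa).mult j (G0.cls (W.extend O.kappa)) =
      ((W.chi a).map (algebraMap O.ring O.kappa)).rootMultiplicity 1 := by
  obtain ⟨a, ha⟩ := FreeMod.baseMap_surjective (R := R) (A := A) (S := O.ring) (T := O.kappa)
    IsLocalRing.residue_surjective (FreeMod.baseMap O.kappa (D.unit j 0 0))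
  refine ⟨a, fun W => ?_⟩
  rw [← FreeMod.chi_extend, ha]
  exact G0.eig_cls _ _

include D in
/-- The reduction of forms is additive. -/
theorem cls_reduction_exact {W₁ W₂ W₃ : FreeMod R A O.ring}
    {V₁ V₂ V₃ : FreeMod R A (FractionRing R)}
    (e₁ : Nonempty ((W₁.extend (FractionRing R)).carrier ≃ₗ[FractionRing R ⊗[R] A] V₁.carrier))
    (e₂ : Nonempty ((W₂.extend (FractionRing R)).carrier ≃ₗ[FractionRing R ⊗[R] A] V₂.carrier))
    (e₃ : Nonempty ((W₃.extend (FractionRing R)).carrier ≃ₗ[FractionRing R ⊗[R] A] V₃.carrier))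
    (f : V₁.carrier →ₗ[FractionRing R ⊗[R] A] V₂.carrier)
    (g : V₂.carrier →ₗ[FractionRing R ⊗[R] A] V₃.carrier)
    (hf : Function.Injective f) (hfg : Function.Exact f g) (hg : Function.Surjective g) :
    G0.cls (W₂.extend O.kappa) = G0.cls (W₁.extend O.kappa) + G0.cls (W₃.extend O.kappa) := by
  refine (D.extend O.kappa).ext_mult fun j => ?_
  obtain ⟨a, ha⟩ := O.mult_reduction D j
  -- The forms need not sit in an exact sequence; as 𝒪 embeds in K, the identity is checked on the
  -- generic fibre.
  have hchi : W₂.chi a = W₁.chi a * W₃.chi a := by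
    apply Polynomial.map_injective (algebraMap O.ring (FractionRing R)) Subtype.val_injective
    rw [Polynomial.map_mul, O.chi_form e₁, O.chi_form e₂, O.chi_form e₃,
      FreeMod.chi_exact f g hf hfg hg]
  rw [map_add]
  refine (ha _).trans (.trans ?_ (congrArg₂ (· + ·) (ha _) (ha _)).symm)
  rw [hchi, Polynomial.map_mul, Polynomial.rootMultiplicity_mul, Nat.cast_add]
  exact (((W₁.chi_monic a).map _).mul ((W₃.chi_monic a).map _)).ne_zero

include D in
/-- The class of the reduction does not depend on the form. -/
theorem cls_reduction_congr {W W' : FreeMod R A O.ring} {V : FreeMod R A (FractionRing R)}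
    (e : Nonempty ((W.extend (FractionRing R)).carrier ≃ₗ[FractionRing R ⊗[R] A] V.carrier))
    (e' : Nonempty ((W'.extend (FractionRing R)).carrier ≃ₗ[FractionRing R ⊗[R] A] V.carrier)) :
    G0.cls (W.extend O.kappa) = G0.cls (W'.extend O.kappa) := by
  refine (D.extend O.kappa).ext_mult fun j => ?_
  obtain ⟨a, ha⟩ := O.mult_reduction D j
  refine (ha _).trans (.trans ?_ (ha _).symm)
  rw [Polynomial.map_injective (algebraMap O.ring (FractionRing R)) Subtype.val_injective
    ((O.chi_form e a).trans (O.chi_form e' a).symm)]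

-- Reduction defines a homomorphism into the Grothendieck group over k(𝔪), which is carried back to
-- k(𝔭) by inverting scalar extension.
include D in
theorem exists_isDecompositionMap (hO : O.IsWeakGate A) :
    ∃ d : G0 R A (FractionRing R) →+ G0 R A p.asIdeal.ResidueField, O.IsDecompositionMap A d := by
  choose W hW using hO
  let red : G0 R A (FractionRing R) →+ G0 R A O.kappa :=
    G0.lift (fun V => G0.cls ((W V).extend O.kappa)) fun V₁ V₂ V₃ f g hf hfg hg =>
      O.cls_reduction_exact D (hW V₁) (hW V₂) (hW V₃) f g hf hfg hg
  let ext := AddEquiv.ofBijective (G0.extend R A p.asIdeal.ResidueField O.kappa)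
    ⟨D.extend_injective O.kappa, D.extend_surjective O.kappa⟩
  refine ⟨ext.symm.toAddMonoidHom.comp red, fun V W' e => ?_⟩
  refine (ext.apply_symm_apply (red (G0.cls V))).trans ?_
  refine (G0.lift_cls _ _ V).trans ?_
  exact O.cls_reduction_congr D (hW V) e

variable {O D} {d : G0 R A (FractionRing R) →+ G0 R A p.asIdeal.ResidueField}

theorem IsDecompositionMap.dim_eq (hd : O.IsDecompositionMap A d) (hO : O.IsWeakGate A)
    (V : FreeMod R A (FractionRing R)) :
    G0.dim (d (G0.cls V)) = Module.finrank (FractionRing R) V.carrier := by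
  obtain ⟨W, e⟩ := hO V
  rw [← G0.dim_extend (L := O.kappa), hd V W e, G0.dim_cls, O.finrank_form e]

variable (D) in
theorem IsDecompositionMap.mult_nonneg (hd : O.IsDecompositionMap A d) (hO : O.IsWeakGate A)
    (V : FreeMod R A (FractionRing R)) (j) : 0 ≤ D.mult j (d (G0.cls V)) := by
  obtain ⟨W, e⟩ := hO V
  rw [← D.mult_extend O.kappa, hd V W e]
  exact (D.extend O.kappa).mult_nonneg j _

-- Otherwise the j-th simple module would not occur in the reduction of the form A^𝒪 of A^K, but the
-- regular module surjects onto every simple module.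
variable (D) in
theorem IsDecompositionMap.exists_mult_ne_zero [Module.Free R A] (hd : O.IsDecompositionMap A d)
    (D' : SplitSystem R A (FractionRing R)) (j) : ∃ i, D.mult j (d (G0.cls (D'.mod i))) ≠ 0 := by
  by_contra! h
  let W : FreeMod R A O.ring := { carrier := O.ring ⊗[R] A }
  have h0 : D.mult j (d (G0.cls (W.extend (FractionRing R)))) = 0 := by
    rw [D'.eq_sum (G0.cls _), map_sum, map_sum]
    refine Finset.sum_eq_zero fun i _ => ?_
    rw [map_zsmul, map_zsmul, h, smul_zero]
  rw [← D.mult_extend O.kappa, hd _ W ⟨LinearEquiv.refl _ _⟩] at h0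
  have hs := (D.extend O.kappa).isSimpleModule j
  let V := (D.extend O.kappa).mod j
  have := IsSimpleModule.nontrivial (O.kappa ⊗[R] A) V.carrier
  obtain ⟨v, hv⟩ := exists_ne (0 : V.carrier)
  let g : W.carrier →+ V.carrier :=
    (AddMonoidHom.flip (smulAddHom (O.kappa ⊗[R] A) V.carrier) v).comp
      (FreeMod.baseMap O.kappa : O.ring ⊗[R] A →ₐ[O.ring] O.kappa ⊗[R] A).toRingHom.toAddMonoidHom
  have hg (b : O.ring ⊗[R] A) (x : W.carrier) : g (b • x) = FreeMod.baseMap O.kappa b • g x :=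
    (congrArg (· • v) (map_mul (FreeMod.baseMap O.kappa) b x)).trans (mul_smul _ _ v)
  let q := FreeMod.extendLift O.kappa W V g hg
  have hq : q ≠ 0 := fun hq => hv <| by
    have h1 := FreeMod.extendLift_tmul O.kappa W V g hg 1 (1 : O.ring ⊗[R] A)
    have h2 : g (1 : O.ring ⊗[R] A) = FreeMod.baseMap O.kappa (1 : O.ring ⊗[R] A) • v := rfl
    rw [one_smul, h2, map_one, one_smul] at h1
    exact h1.symm.trans (DFunLike.congr_fun hq _)
  have hqs : Function.Surjective q := LinearMap.surjective_of_ne_zero hq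
  have hcls := G0.cls_eq_add (V₁ := (W.extend O.kappa).sub (LinearMap.ker q)) (V₂ := W.extend O.kappa)
    (V₃ := V) (LinearMap.ker q).subtype q Subtype.val_injective
    (LinearMap.exact_subtype_ker_map q) hqs
  have h3 := (D.extend O.kappa).mult_nonneg j ((W.extend O.kappa).sub (LinearMap.ker q))
  have h4 := ((D.extend O.kappa).mult_mod j j).trans (if_pos rfl)
  have h5 := congrArg ((D.extend O.kappa).mult j) hcls
  rw [map_add] at h5
  -- The multiplicity 0 would be a non-negative number plus 1.
  have h6 := h0.symm.trans (h5.trans (congrArg (_ + ·) h4))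
  omega

/-- The entries of the decomposition matrix. -/
theorem IsDecompositionMap.exists_matrix [Module.Free R A] (hd : O.IsDecompositionMap A d)
    (hO : O.IsWeakGate A) (D : SplitSystem R A p.asIdeal.ResidueField)
    (D' : SplitSystem R A (FractionRing R)) :
    ∃ c : Fin D'.card → Fin D.card → ℕ,
      (∀ i, d (G0.cls (D'.mod i)) = ∑ j, c i j • G0.cls (D.mod j)) ∧
      (∀ j, ∃ i, c i j ≠ 0) ∧ ∀ i, D'.deg i = ∑ j, c i j * D.deg j := by
  have hcast (i j) : (((D.mult j (d (G0.cls (D'.mod i)))).toNat : ℕ) : ℤ) =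
      D.mult j (d (G0.cls (D'.mod i))) := Int.toNat_of_nonneg (hd.mult_nonneg D hO _ j)
  have hsum (i) : d (G0.cls (D'.mod i)) =
      ∑ j, (D.mult j (d (G0.cls (D'.mod i)))).toNat • G0.cls (D.mod j) := by
    conv_lhs => rw [D.eq_sum (d _)]
    refine Finset.sum_congr rfl fun j _ => ?_
    rw [← natCast_zsmul, hcast]
  refine ⟨fun i j => (D.mult j (d (G0.cls (D'.mod i)))).toNat, hsum, fun j => ?_, fun i => ?_⟩
  · obtain ⟨i, hi⟩ := hd.exists_mult_ne_zero D D' j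
    exact ⟨i, fun h => hi ((hcast i j).symm.trans (congrArg Nat.cast h))⟩
  · have h := hd.dim_eq hO (D'.mod i)
    rw [hsum, D'.finrank_mod, map_sum] at h
    simp_rw [map_nsmul, G0.dim_cls, D.finrank_mod, nsmul_eq_mul] at h
    exact_mod_cast h.symm

theorem sum_sq_deg_le [Module.Free R A] (hO : O.IsWeakGate A)
    (D : SplitSystem R A p.asIdeal.ResidueField) (D' : SplitSystem R A (FractionRing R)) :
    ∑ j, D.deg j ^ 2 ≤ ∑ i, D'.deg i ^ 2 := by
  obtain ⟨d, hd⟩ := O.exists_isDecompositionMap D hO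
  obtain ⟨c, -, hcol, hrow⟩ := hd.exists_matrix hO D D'
  exact sum_sq_le_of_decomposition hcol hrow

/-- The decomposition map is trivial if and only if the semisimple quotients of the two fibres have
the same dimension. -/
theorem hasTrivialDecompositionMap_iff [Module.Free R A] (hO : O.IsWeakGate A)
    (D : SplitSystem R A p.asIdeal.ResidueField) (D' : SplitSystem R A (FractionRing R)) :
    O.HasTrivialDecompositionMap A ↔ ∑ j, D.deg j ^ 2 = ∑ i, D'.deg i ^ 2 := by
  constructor
  -- A trivial map matches the simple modules, and it preserves dimensions.
  · rintro ⟨d, hd, hbij⟩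
    rw [D.simpleClasses_eq, D'.simpleClasses_eq] at hbij
    choose π hπ using fun i => hbij.mapsTo ⟨i, rfl⟩
    have hπ' (i) : G0.cls (D.mod (π i)) = d (G0.cls (D'.mod i)) := hπ i
    have hb : Function.Bijective π := by
      refine ⟨fun i j hij => D'.cls_mod_injective (hbij.injOn ⟨i, rfl⟩ ⟨j, rfl⟩ ?_), fun j => ?_⟩
      · exact (hπ' i).symm.trans ((congrArg (fun l => G0.cls (D.mod l)) hij).trans (hπ' j))
      · obtain ⟨_, ⟨i, rfl⟩, hi⟩ := hbij.surjOn ⟨j, rfl⟩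
        exact ⟨i, D.cls_mod_injective ((hπ' i).trans hi)⟩
    rw [← Function.Bijective.sum_comp hb fun j => D.deg j ^ 2]
    refine Finset.sum_congr rfl fun i _ => ?_
    have h := hd.dim_eq hO (D'.mod i)
    rw [← hπ', G0.dim_cls, D.finrank_mod, D'.finrank_mod] at h
    rw [Nat.cast_injective h]
  · intro h
    obtain ⟨d, hd⟩ := O.exists_isDecompositionMap D hO
    obtain ⟨c, hsum, hcol, hrow⟩ := hd.exists_matrix hO D D'
    obtain ⟨π, hπ, hc⟩ := exists_bijective_of_decomposition (fun i => NeZero.ne (D'.deg i))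
      (fun j => NeZero.ne (D.deg j)) hcol hrow h
    have hdπ (i) : d (G0.cls (D'.mod i)) = G0.cls (D.mod (π i)) := by
      rw [hsum, Finset.sum_eq_single (π i)]
      · rw [hc, if_pos rfl, one_smul]
      · intro j _ hj
        rw [hc, if_neg (Ne.symm hj), zero_smul]
      · simp
    refine ⟨d, hd, ?_⟩
    rw [D.simpleClasses_eq, D'.simpleClasses_eq]
    refine ⟨?_, ?_, ?_⟩
    · rintro _ ⟨i, rfl⟩
      exact ⟨π i, (hdπ i).symm⟩
    · rintro _ ⟨i, rfl⟩ _ ⟨j, rfl⟩ hij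
      have h' := D.cls_mod_injective ((hdπ i).symm.trans (hij.trans (hdπ j)))
      rw [hπ.1 h']
    · rintro _ ⟨j, rfl⟩
      obtain ⟨i, rfl⟩ := hπ.2 j
      exact ⟨_, ⟨i, rfl⟩, hdπ i⟩

end LocalOver

/-! ### A criterion for the generic locus -/

section Criterion

variable {R : Type u} [CommRing R] [IsDomain R] {A : Type v} [Ring A] [Algebra R A]
  [Module.Finite R A] [Module.Free R A]
  (hK : IsSplit (FractionRing R) (FractionRing R ⊗[R] A)) {p : PrimeSpectrum R}
  (hp : IsSplit p.asIdeal.ResidueField (p.asIdeal.ResidueField ⊗[R] A))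

include hK hp

theorem radRank_fiber_le : radRank p.asIdeal.ResidueField (p.asIdeal.ResidueField ⊗[R] A) ≤
    radRank (FractionRing R) (FractionRing R ⊗[R] A) := by
  obtain ⟨D, hD⟩ := SplitSystem.exists_of_isSplit hp
  obtain ⟨D', hD'⟩ := SplitSystem.exists_of_isSplit hK
  obtain ⟨O, hO⟩ := LocalOver.exists_valuation p
  rw [← hD, ← hD']
  exact LocalOver.sum_sq_deg_le (O.isWeakGate_of_valuation A hO) D D'

/-- The numerical criterion does not mention the gate: a valuation ring supplies one for the first
direction, and the second treats all gates at once. -/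
theorem mem_decGen_iff : p ∈ decGen R A ↔
    radRank p.asIdeal.ResidueField (p.asIdeal.ResidueField ⊗[R] A) =
      radRank (FractionRing R) (FractionRing R ⊗[R] A) := by
  obtain ⟨D, hD⟩ := SplitSystem.exists_of_isSplit hp
  obtain ⟨D', hD'⟩ := SplitSystem.exists_of_isSplit hK
  obtain ⟨O, hO⟩ := LocalOver.exists_valuation p
  have hw := O.isWeakGate_of_valuation A hO
  rw [← hD, ← hD']
  constructor
  · rintro ⟨-, h⟩
    exact (LocalOver.hasTrivialDecompositionMap_iff hw D D').1
      (h O (O.isGate_of_isWeakGate A D hw))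
  · intro h
    exact ⟨⟨O, O.isGate_of_isWeakGate A D hw⟩, fun O' hO' =>
      (LocalOver.hasTrivialDecompositionMap_iff hO'.1 D D').2 h⟩

end Criterion

/-! ### Generic lower bound for the semisimple quotients of the fibres -/

section Generic

/-- The product of matrix algebras of the sizes `n i`. -/
abbrev PiMatrix {m : ℕ} (n : Fin m → ℕ) (S : Type*) : Type _ :=
  ∀ i, Matrix (Fin (n i)) (Fin (n i)) S

/-- Functoriality of products of matrix algebras in the coefficients. -/
def PiMatrix.map (R : Type*) [CommRing R] {m : ℕ} (n : Fin m → ℕ) {S T : Type*} [CommRing S]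
    [CommRing T] [Algebra R S] [Algebra R T] (f : S →ₐ[R] T) : PiMatrix n S →ₐ[R] PiMatrix n T :=
  AlgHom.pi (R := R) fun i => f.mapMatrix.comp (Pi.evalAlgHom R _ i)

theorem PiMatrix.map_apply (R : Type*) [CommRing R] {m : ℕ} (n : Fin m → ℕ) {S T : Type*}
    [CommRing S] [CommRing T] [Algebra R S] [Algebra R T] (f : S →ₐ[R] T) (x : PiMatrix n S)
    (i r s) : PiMatrix.map R n f x i r s = f (x i r s) := rfl

/-- The matrix units. -/
def PiMatrix.unit {m : ℕ} {n : Fin m → ℕ} (S : Type*) [CommRing S] (i) (r s : Fin (n i)) :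
    PiMatrix n S := Pi.single i (Matrix.single r s 1)

theorem PiMatrix.map_unit (R : Type*) [CommRing R] {m : ℕ} (n : Fin m → ℕ) {S T : Type*}
    [CommRing S] [CommRing T] [Algebra R S] [Algebra R T] (f : S →ₐ[R] T) (i) (r s : Fin (n i)) :
    PiMatrix.map R n f (PiMatrix.unit S i r s) = PiMatrix.unit T i r s := by
  ext j p q
  rw [PiMatrix.map_apply]
  by_cases hij : j = i
  · subst hij
    simp only [unit, Pi.single_eq_same, Matrix.single_apply]
    split_ifs <;> simp
  · simp [unit, Pi.single_eq_of_ne hij]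

theorem PiMatrix.eq_sum {m : ℕ} {n : Fin m → ℕ} {S : Type*} [CommRing S] (x : PiMatrix n S) :
    x = ∑ i, ∑ r, ∑ s, x i r s • PiMatrix.unit S i r s := by
  ext j p q
  simp only [Finset.sum_apply]
  rw [Finset.sum_eq_single j]
  · have h (r s) : (x j r s • PiMatrix.unit S j r s) j = Matrix.single r s (x j r s) := by
      simp [unit]
    simp_rw [h]
    rw [← Matrix.matrix_eq_sum_single]
  · intro i _ hij
    simp [unit, Pi.single_eq_of_ne hij.symm]
  · simp

variable {R : Type u} [CommRing R] [IsDomain R] {A : Type v} [Ring A] [Algebra R A]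

omit [IsDomain R] in
/-- Every element of `Frac(R) ⊗ A` has a denominator. -/
theorem exists_smul_eq_tmul (x : FractionRing R ⊗[R] A) :
    ∃ h ∈ nonZeroDivisors R, ∃ a : A, h • x = (1 : FractionRing R) ⊗ₜ[R] a := by
  have : IsLocalizedModule (nonZeroDivisors R) (TensorProduct.mk R (FractionRing R) A 1) :=
    (isLocalizedModule_iff_isBaseChange (nonZeroDivisors R) (FractionRing R) _).2
      (TensorProduct.isBaseChange R A (FractionRing R))
  obtain ⟨⟨a, h⟩, ha⟩ := IsLocalizedModule.surj (nonZeroDivisors R)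
    (TensorProduct.mk R (FractionRing R) A 1) x
  exact ⟨h, h.2, a, ha⟩

variable [Module.Finite R A]

/-- There is a common denominator for the values of a linear map into `Frac(R)`-matrices. -/
theorem exists_denominator {m : ℕ} {n : Fin m → ℕ}
    (σ : A →ₗ[R] PiMatrix n (FractionRing R)) :
    ∃ g : R, g ≠ 0 ∧ ∀ a i r s, ∃ c : R, algebraMap R _ c = algebraMap R _ g * σ a i r s := by
  obtain ⟨N, b, hb⟩ := Module.Finite.exists_fin (R := R) (M := A)
  obtain ⟨g, hg⟩ := IsLocalization.exist_integer_multiples_of_finite (nonZeroDivisors R)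
    fun x : Fin N × Σ i, Fin (n i) × Fin (n i) => σ (b x.1) x.2.1 x.2.2.1 x.2.2.2
  refine ⟨g, nonZeroDivisors.ne_zero g.2, fun a i r s => ?_⟩
  have ha : a ∈ Submodule.span R (Set.range b) := hb ▸ Submodule.mem_top
  induction ha using Submodule.span_induction with
  | mem x hx =>
    obtain ⟨l, rfl⟩ := hx
    obtain ⟨c, hc⟩ := hg (l, ⟨i, r, s⟩)
    exact ⟨c, hc.trans (Algebra.smul_def _ _)⟩
  | zero => exact ⟨0, by simp⟩
  | add x y _ _ hx hy =>
    obtain ⟨c, hc⟩ := hx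
    obtain ⟨d, hd⟩ := hy
    refine ⟨c + d, ?_⟩
    rw [map_add, hc, hd, map_add, Pi.add_apply, Matrix.add_apply, mul_add]
  | smul t x _ hx =>
    obtain ⟨c, hc⟩ := hx
    refine ⟨t * c, ?_⟩
    rw [map_mul, hc, map_smul, Pi.smul_apply, Matrix.smul_apply, Algebra.smul_def]
    ring

/-- The dimension of the semisimple quotient of the fibres of `A` is bounded below by its generic
value on a non-empty open subset. -/
theorem exists_radRank_le (hK : IsSplit (FractionRing R) (FractionRing R ⊗[R] A)) :
    ∃ f : R, f ≠ 0 ∧ ∀ p : PrimeSpectrum R, f ∉ p.asIdeal →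
      radRank (FractionRing R) (FractionRing R ⊗[R] A) ≤
        radRank p.asIdeal.ResidueField (p.asIdeal.ResidueField ⊗[R] A) := by
  obtain ⟨m, n, ρ, -, hρ, hker⟩ := hK.exists_surjective_pi_matrix
  let σ : A →ₐ[R] PiMatrix n (FractionRing R) :=
    (ρ.restrictScalars R).comp Algebra.TensorProduct.includeRight
  obtain ⟨g, hg0, hg⟩ := exists_denominator σ.toLinearMap
  choose x hx using fun i (r s : Fin (n i)) => hρ (PiMatrix.unit (FractionRing R) i r s)
  choose h hh a ha using fun i (r s : Fin (n i)) => exists_smul_eq_tmul (x i r s)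
  have hσ (i r s) : σ (a i r s) = h i r s • PiMatrix.unit (FractionRing R) i r s := by
    change ρ (1 ⊗ₜ a i r s) = _
    rw [← ha, ← hx]
    exact map_smul (ρ.restrictScalars R) _ _
  -- Inverting g makes the images of A integral, and inverting the h i r s keeps the matrix units in
  -- the image.
  refine ⟨g * ∏ i, ∏ r, ∏ s, h i r s, mul_ne_zero hg0 ?_, fun p hp => ?_⟩
  · exact Finset.prod_ne_zero_iff.2 fun i _ => Finset.prod_ne_zero_iff.2 fun r _ =>
      Finset.prod_ne_zero_iff.2 fun s _ => nonZeroDivisors.ne_zero (hh i r s)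
  have hgp : g ∉ p.asIdeal := fun hgp => hp (Ideal.mul_mem_right _ _ hgp)
  have hhp (i r s) : h i r s ∉ p.asIdeal := fun hi => hp <| Ideal.mul_mem_left _ _ <|
    Ideal.mem_of_dvd _ ((Finset.dvd_prod_of_mem _ (Finset.mem_univ s)).trans <|
      (Finset.dvd_prod_of_mem (fun r => ∏ s, h i r s) (Finset.mem_univ r)).trans <|
      Finset.dvd_prod_of_mem (fun i => ∏ r, ∏ s, h i r s) (Finset.mem_univ i)) hi
  let L := Localization.AtPrime p.asIdeal
  have hunit (y : p.asIdeal.primeCompl) : IsUnit (Algebra.ofId R (FractionRing R) y) :=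
    isUnit_iff_ne_zero.2 (IsFractionRing.to_map_ne_zero_of_mem_nonZeroDivisors
      (p.asIdeal.primeCompl_le_nonZeroDivisors y.2))
  let j : L →ₐ[R] FractionRing R := IsLocalization.liftAlgHom (M := p.asIdeal.primeCompl) hunit
  have hj : Function.Injective j := by
    refine (IsLocalization.lift_injective_iff (M := p.asIdeal.primeCompl) hunit).2 fun y z => ?_
    rw [(IsLocalization.injective L p.asIdeal.primeCompl_le_nonZeroDivisors).eq_iff]
    exact (IsFractionRing.injective R (FractionRing R)).eq_iff.symm
  let ψ := PiMatrix.map R n j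
  have hψ : Function.Injective ψ := fun y z hyz => by
    ext i r s
    exact hj (congrFun (congrFun (congrFun hyz i) r) s)
  -- As g is a unit in R_𝔭, σ takes values in matrices over R_𝔭 and can be reduced to k(𝔭).
  have hrange (b : A) : σ b ∈ ψ.range := by
    choose c hc using hg b
    let g' : p.asIdeal.primeCompl := ⟨g, hgp⟩
    refine ⟨fun i => Matrix.of fun r s => IsLocalization.mk' L (c i r s) g', ?_⟩
    ext i r s
    change IsLocalization.lift hunit (IsLocalization.mk' L (c i r s) g') = σ b i r s
    rw [IsLocalization.lift_mk'_spec]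
    exact hc i r s
  let σ' : A →ₐ[R] PiMatrix n L :=
    ((AlgEquiv.ofInjective ψ hψ).symm : ψ.range →ₐ[R] PiMatrix n L).comp (σ.codRestrict _ hrange)
  have hσ' (b : A) : ψ (σ' b) = σ b :=
    congrArg Subtype.val ((AlgEquiv.ofInjective ψ hψ).apply_symm_apply ⟨σ b, hrange b⟩)
  let k := p.asIdeal.ResidueField
  let τ : A →ₐ[R] PiMatrix n k := (PiMatrix.map R n (IsScalarTower.toAlgHom R L k)).comp σ'
  have hτ (i r s) : τ (a i r s) = algebraMap R k (h i r s) • PiMatrix.unit k i r s := by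
    have h1 : σ' (a i r s) = h i r s • PiMatrix.unit L i r s := by
      apply hψ
      rw [hσ', hσ, map_smul, PiMatrix.map_unit]
    change PiMatrix.map R n _ (σ' _) = _
    rw [h1, map_smul, PiMatrix.map_unit, algebraMap_smul]
  let φ : k ⊗[R] A →ₐ[k] PiMatrix n k :=
    Algebra.TensorProduct.lift (Algebra.ofId k _) τ fun _ _ => Algebra.commutes _ _
  have hφ (i r s) : φ ((algebraMap R k (h i r s))⁻¹ ⊗ₜ a i r s) = PiMatrix.unit k i r s := by
    have h0 : algebraMap R k (h i r s) ≠ 0 := fun h0 =>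
      hhp i r s (Ideal.algebraMap_residueField_eq_zero.1 h0)
    refine (Algebra.TensorProduct.lift_tmul ..).trans ?_
    rw [hτ, Algebra.ofId_apply, ← Algebra.smul_def, smul_smul, inv_mul_cancel₀ h0, one_smul]
  have hφs : Function.Surjective φ := fun y => by
    change y ∈ φ.range
    rw [PiMatrix.eq_sum y]
    exact Subalgebra.sum_mem _ fun i _ => Subalgebra.sum_mem _ fun r _ =>
      Subalgebra.sum_mem _ fun s _ => φ.range.smul_mem ⟨_, hφ i r s⟩ _
  rw [finrank_eq_of_surjective _ ρ hρ hker, finrank_pi_matrix]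
  exact sum_sq_le_radRank k n φ hφs

end Generic

/-! ### Comparison of the fibres of `A` and of `A|_ξ` -/

section Transfer

variable {R : Type u} [CommRing R]

/-- The residue field at 𝔭 is characterized by its kernel and by fractions; this identifies residue
and fraction fields of R and R/ξ. -/
theorem nonempty_residueField_algEquiv (p : PrimeSpectrum R) {F : Type u} [Field F] [Algebra R F]
    (hker : ∀ r, algebraMap R F r = 0 ↔ r ∈ p.asIdeal)
    (hdiv : ∀ x : F, ∃ a b : R, algebraMap R F a / algebraMap R F b = x) :
    Nonempty (p.asIdeal.ResidueField ≃ₐ[R] F) := by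
  let f : p.asIdeal.ResidueField →ₐ[R] F := Ideal.ResidueField.liftₐ p.asIdeal (Algebra.ofId R F)
    (fun r hr => (hker r).2 hr) fun r hr => isUnit_iff_ne_zero.2 fun h => hr ((hker r).1 h)
  refine ⟨AlgEquiv.ofBijective f ⟨f.toRingHom.injective, fun x => ?_⟩⟩
  obtain ⟨a, b, rfl⟩ := hdiv x
  refine ⟨algebraMap R _ a / algebraMap R _ b, ?_⟩
  rw [map_div₀, AlgHom.commutes, AlgHom.commutes]

variable {A : Type v} [Ring A] [Algebra R A] {S : Type u} [CommRing S] [Algebra R S]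
  {F F' : Type u} [Field F] [Field F'] [Algebra R F'] [Algebra R F] [Algebra S F]
  [IsScalarTower R S F]

omit [Field F'] [Algebra R F'] in
variable (A S F) in
theorem bijective_toBaseChange :
    Function.Bijective (FreeMod.toBaseChange F : F ⊗[R] A →ₐ[F] F ⊗[S] (S ⊗[R] A)) := by
  let e := TensorProduct.AlgebraTensorModule.cancelBaseChange R S F F A
  have h : (FreeMod.toBaseChange F : F ⊗[R] A →ₐ[F] F ⊗[S] (S ⊗[R] A)).toLinearMap =
      e.symm.toLinearMap := by
    apply TensorProduct.AlgebraTensorModule.ext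
    intro c a
    have hc : (FreeMod.toBaseChange F : F ⊗[R] A →ₐ[F] F ⊗[S] (S ⊗[R] A)) (c ⊗ₜ[R] a) =
        c ⊗ₜ[S] (1 ⊗ₜ[R] a) := by
      refine (Algebra.TensorProduct.lift_tmul _ _ _ c a).trans ?_
      simp [Algebra.ofId_apply]
    exact hc.trans (TensorProduct.AlgebraTensorModule.cancelBaseChange_symm_tmul ..).symm
  have h' : ⇑(FreeMod.toBaseChange F : F ⊗[R] A →ₐ[F] F ⊗[S] (S ⊗[R] A)) = e.symm :=
    congrArg DFunLike.coe h
  rw [h']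
  exact e.symm.bijective

variable (A S) in
/-- Transitivity of scalar extension, combined with an isomorphism of fields. -/
def fiberEquiv (e : F' ≃ₐ[R] F) : F' ⊗[R] A ≃+* F ⊗[S] (S ⊗[R] A) :=
  (Algebra.TensorProduct.congr e AlgEquiv.refl).toRingEquiv.trans
    (AlgEquiv.ofBijective (FreeMod.toBaseChange F : F ⊗[R] A →ₐ[F] F ⊗[S] (S ⊗[R] A))
      (bijective_toBaseChange A S F)).toRingEquiv

theorem fiberEquiv_algebraMap (e : F' ≃ₐ[R] F) (c : F') :
    fiberEquiv A S e (algebraMap F' _ c) = algebraMap F _ (e c) := by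
  change (FreeMod.toBaseChange F : F ⊗[R] A →ₐ[F] F ⊗[S] (S ⊗[R] A))
    (Algebra.TensorProduct.congr e AlgEquiv.refl (c ⊗ₜ 1)) = _
  rw [Algebra.TensorProduct.congr_apply, Algebra.TensorProduct.map_tmul, map_one]
  exact AlgHom.commutes (FreeMod.toBaseChange F : F ⊗[R] A →ₐ[F] F ⊗[S] (S ⊗[R] A)) (e c)

theorem radRank_fiber_congr (e : F' ≃ₐ[R] F) :
    radRank F' (F' ⊗[R] A) = radRank F (F ⊗[S] (S ⊗[R] A)) :=
  radRank_congr e.toRingEquiv (fiberEquiv A S e) (fiberEquiv_algebraMap e)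

theorem IsSplit.fiber_congr (e : F' ≃ₐ[R] F) (h : IsSplit F' (F' ⊗[R] A)) :
    IsSplit F (F ⊗[S] (S ⊗[R] A)) :=
  h.congr e.toRingEquiv (fiberEquiv A S e) (fiberEquiv_algebraMap e)

theorem nonempty_algEquiv_quotient (ξ : PrimeSpectrum R)
    (q : PrimeSpectrum (R ⧸ ξ.asIdeal)) :
    Nonempty ((PrimeSpectrum.comap (Ideal.Quotient.mk ξ.asIdeal) q).asIdeal.ResidueField ≃ₐ[R]
      q.asIdeal.ResidueField) := by
  refine nonempty_residueField_algEquiv _ (fun r => ?_) fun x => ?_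
  · rw [IsScalarTower.algebraMap_apply R (R ⧸ ξ.asIdeal), Ideal.algebraMap_residueField_eq_zero]
    rfl
  · obtain ⟨a, b, -, rfl⟩ := IsFractionRing.div_surjective
      (A := (R ⧸ ξ.asIdeal) ⧸ q.asIdeal) x
    obtain ⟨a, rfl⟩ := Ideal.Quotient.mk_surjective a
    obtain ⟨b, rfl⟩ := Ideal.Quotient.mk_surjective b
    obtain ⟨a, rfl⟩ := Ideal.Quotient.mk_surjective a
    obtain ⟨b, rfl⟩ := Ideal.Quotient.mk_surjective b
    exact ⟨a, b, rfl⟩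

theorem nonempty_algEquiv_fractionRing_quotient (ξ : PrimeSpectrum R) :
    Nonempty (ξ.asIdeal.ResidueField ≃ₐ[R] FractionRing (R ⧸ ξ.asIdeal)) := by
  refine nonempty_residueField_algEquiv _ (fun r => ?_) fun x => ?_
  · rw [IsScalarTower.algebraMap_apply R (R ⧸ ξ.asIdeal),
      IsFractionRing.to_map_eq_zero_iff, Ideal.Quotient.algebraMap_eq,
      Ideal.Quotient.eq_zero_iff_mem]
  · obtain ⟨a, b, -, rfl⟩ := IsFractionRing.div_surjective (A := R ⧸ ξ.asIdeal) x
    obtain ⟨a, rfl⟩ := Ideal.Quotient.mk_surjective a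
    obtain ⟨b, rfl⟩ := Ideal.Quotient.mk_surjective b
    exact ⟨a, b, rfl⟩

theorem nonempty_algEquiv_fractionRing [IsDomain R] :
    Nonempty ((⊥ : PrimeSpectrum R).asIdeal.ResidueField ≃ₐ[R] FractionRing R) := by
  refine nonempty_residueField_algEquiv _ (fun r => ?_) fun x => ?_
  · rw [IsFractionRing.to_map_eq_zero_iff]
    rfl
  · obtain ⟨a, b, -, rfl⟩ := IsFractionRing.div_surjective (A := R) x
    exact ⟨a, b, rfl⟩

theorem radRank_congr_left (e : F' ≃ₐ[R] F) :
    radRank F' (F' ⊗[R] A) = radRank F (F ⊗[R] A) :=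
  radRank_congr e.toRingEquiv (Algebra.TensorProduct.congr e AlgEquiv.refl).toRingEquiv fun c => by
    change Algebra.TensorProduct.congr e AlgEquiv.refl (c ⊗ₜ 1) = _
    rw [Algebra.TensorProduct.congr_apply, Algebra.TensorProduct.map_tmul, map_one]
    rfl

theorem IsSplit.congr_left (e : F' ≃ₐ[R] F) (h : IsSplit F' (F' ⊗[R] A)) :
    IsSplit F (F ⊗[R] A) :=
  h.congr e.toRingEquiv (Algebra.TensorProduct.congr e AlgEquiv.refl).toRingEquiv fun c => by
    change Algebra.TensorProduct.congr e AlgEquiv.refl (c ⊗ₜ 1) = _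
    rw [Algebra.TensorProduct.congr_apply, Algebra.TensorProduct.map_tmul, map_one]
    rfl

end Transfer

/-! ### The dimension of the semisimple quotient as a function on the spectrum -/

section FiberRank

variable {R : Type u} [CommRing R] (A : Type v) [Ring A] [Algebra R A]

/-- The dimension of the semisimple quotient of the fibre `A(𝔭)`. -/
def fiberRank (p : PrimeSpectrum R) : ℕ :=
  radRank p.asIdeal.ResidueField (p.asIdeal.ResidueField ⊗[R] A)

variable {A}

theorem exists_comap_quotient_eq {ξ p : PrimeSpectrum R} (h : ξ ≤ p) :
    ∃ q, PrimeSpectrum.comap (Ideal.Quotient.mk ξ.asIdeal) q = p := by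
  have : p ∈ Set.range (PrimeSpectrum.comap (Ideal.Quotient.mk ξ.asIdeal)) := by
    rw [range_comap_of_surjective _ _ Ideal.Quotient.mk_surjective, Ideal.mk_ker]
    exact h
  exact this

theorem le_comap_quotient (ξ : PrimeSpectrum R) (q : PrimeSpectrum (R ⧸ ξ.asIdeal)) :
    ξ ≤ PrimeSpectrum.comap (Ideal.Quotient.mk ξ.asIdeal) q := by
  intro r hr
  change Ideal.Quotient.mk ξ.asIdeal r ∈ q.asIdeal
  rw [Ideal.Quotient.eq_zero_iff_mem.2 hr]
  exact zero_mem _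

variable [Module.Finite R A] [Module.Free R A]
  (hsplit : ∀ p : PrimeSpectrum R,
    IsSplit p.asIdeal.ResidueField (p.asIdeal.ResidueField ⊗[R] A))

include hsplit

/-- Over R/ξ the fibre A(ξ) becomes generic, and the comparison of special and generic fibre
applies. -/
theorem fiberRank_antitone : Antitone (fiberRank (R := R) A) := by
  intro ξ p h
  obtain ⟨q, rfl⟩ := exists_comap_quotient_eq h
  obtain ⟨e⟩ := nonempty_algEquiv_quotient ξ q
  obtain ⟨e'⟩ := nonempty_algEquiv_fractionRing_quotient ξ
  rw [fiberRank, fiberRank, radRank_fiber_congr (S := R ⧸ ξ.asIdeal) e,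
    radRank_fiber_congr (S := R ⧸ ξ.asIdeal) e']
  exact radRank_fiber_le ((hsplit _).fiber_congr e') ((hsplit _).fiber_congr e)

/-- One inequality is antitonicity, the other is spreading out over R/ξ. -/
theorem exists_fiberRank_eq (ξ : PrimeSpectrum R) :
    ∃ f ∉ ξ.asIdeal, ∀ p, ξ ≤ p → f ∉ p.asIdeal → fiberRank A p = fiberRank A ξ := by
  obtain ⟨e'⟩ := nonempty_algEquiv_fractionRing_quotient ξ
  obtain ⟨f, hf, hle⟩ := exists_radRank_le (R := R ⧸ ξ.asIdeal) (A := (R ⧸ ξ.asIdeal) ⊗[R] A)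
    ((hsplit _).fiber_congr e')
  obtain ⟨f, rfl⟩ := Ideal.Quotient.mk_surjective f
  refine ⟨f, fun h => hf (Ideal.Quotient.eq_zero_iff_mem.2 h), fun p hp hfp =>
    (fiberRank_antitone hsplit hp).antisymm ?_⟩
  obtain ⟨q, rfl⟩ := exists_comap_quotient_eq hp
  obtain ⟨e⟩ := nonempty_algEquiv_quotient ξ q
  rw [fiberRank, fiberRank, radRank_fiber_congr (S := R ⧸ ξ.asIdeal) e,
    radRank_fiber_congr (S := R ⧸ ξ.asIdeal) e']
  exact hle q hfp

theorem decGenAt_eq (ξ : PrimeSpectrum R) :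
    decGenAt R A ξ = {p | ξ ≤ p ∧ fiberRank A p = fiberRank A ξ} := by
  obtain ⟨e'⟩ := nonempty_algEquiv_fractionRing_quotient ξ
  have key (q : PrimeSpectrum (R ⧸ ξ.asIdeal)) :
      q ∈ decGen (R ⧸ ξ.asIdeal) ((R ⧸ ξ.asIdeal) ⊗[R] A) ↔
        fiberRank A (PrimeSpectrum.comap (Ideal.Quotient.mk ξ.asIdeal) q) = fiberRank A ξ := by
    obtain ⟨e⟩ := nonempty_algEquiv_quotient ξ q
    rw [mem_decGen_iff ((hsplit _).fiber_congr e') ((hsplit _).fiber_congr e), fiberRank,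
      fiberRank, radRank_fiber_congr (S := R ⧸ ξ.asIdeal) e,
      radRank_fiber_congr (S := R ⧸ ξ.asIdeal) e']
  ext p
  constructor
  · rintro ⟨q, hq, rfl⟩
    exact ⟨le_comap_quotient ξ q, (key q).1 hq⟩
  · rintro ⟨hp, h⟩
    obtain ⟨q, rfl⟩ := exists_comap_quotient_eq hp
    exact ⟨q, (key q).2 h, rfl⟩

theorem decGen_eq [IsDomain R] : decGen R A = {p | fiberRank A p = fiberRank A (⊥ : PrimeSpectrum R)} := by
  obtain ⟨e⟩ := nonempty_algEquiv_fractionRing (R := R)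
  ext p
  rw [mem_decGen_iff ((hsplit _).congr_left e) (hsplit p), Set.mem_ofPred_eq, fiberRank, fiberRank,
    radRank_congr_left e]

end FiberRank

end

end DecompositionMaps

namespace DecompositionMaps

/-! ### Functions on noetherian spectra and stratifications -/

section Topology

open PrimeSpectrum

variable {R : Type u} [CommRing R]

theorem isClosed_Ici (ξ : PrimeSpectrum R) : IsClosed (Set.Ici ξ) := by
  rw [show Set.Ici ξ = closure {ξ} by
    rw [PrimeSpectrum.closure_singleton]
    rfl]
  exact isClosed_closure

theorem mem_of_le_of_isClosed {T : Set (PrimeSpectrum R)} (hT : IsClosed T) {p q : PrimeSpectrum R}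
    (hp : p ∈ T) (h : p ≤ q) : q ∈ T :=
  ((le_iff_specializes p q).1 h).mem_closed hT hp

variable [IsNoetherianRing R]

instance : WellFoundedGT (PrimeSpectrum R) :=
  ⟨Subrelation.wf (r := InvImage (· > ·) PrimeSpectrum.asIdeal) (fun h => h)
    (InvImage.wf _ wellFounded_gt)⟩

/-- For T = V(I) these are the minimal primes over I. -/
theorem finite_minimal_of_isClosed {T : Set (PrimeSpectrum R)} (hT : IsClosed T) :
    {p | Minimal (· ∈ T) p}.Finite := by
  obtain ⟨I, rfl⟩ := (isClosed_iff_zeroLocus_ideal T).1 hT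
  refine Set.Finite.of_finite_image ((Ideal.finite_minimalPrimes_of_isNoetherianRing R I).subset ?_)
    (f := PrimeSpectrum.asIdeal) (fun _ _ _ _ h => PrimeSpectrum.ext h)
  rintro _ ⟨p, hp, rfl⟩
  exact ⟨⟨p.2, hp.1⟩, fun J hJ hle => hp.2 (y := ⟨J, hJ.1⟩) hJ.2 hle⟩

omit [IsNoetherianRing R] in
theorem exists_minimal_le_of_isClosed {T : Set (PrimeSpectrum R)} (hT : IsClosed T)
    {p : PrimeSpectrum R} (hp : p ∈ T) : ∃ q, Minimal (· ∈ T) q ∧ q ≤ p := by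
  obtain ⟨I, rfl⟩ := (isClosed_iff_zeroLocus_ideal T).1 hT
  obtain ⟨J, hJ, hJp⟩ := Ideal.exists_minimalPrimes_le (I := I) (J := p.asIdeal) hp
  exact ⟨⟨J, hJ.1.1⟩, ⟨hJ.1.2, fun q hq hle => hJ.2 ⟨q.2, hq⟩ hle⟩, hJp⟩

/-- The sublevel sets of an antitone function that is generically constant on all irreducible
closed subsets are closed. -/
theorem isClosed_lt_of_generic [IsDomain R] {F : PrimeSpectrum R → ℕ} (hF : Antitone F)
    (hgen : ∀ ξ, ∃ f ∉ ξ.asIdeal, ∀ p, ξ ≤ p → f ∉ p.asIdeal → F p = F ξ) (c : ℕ) :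
    IsClosed {p | F p < c} := by
  -- Noetherian induction: the claim is assumed for all primes strictly above ξ.
  have key (ξ : PrimeSpectrum R) : IsClosed (Set.Ici ξ ∩ {p | F p < c}) := by
    induction ξ using WellFoundedGT.induction with
    | _ ξ ih =>
      by_cases hξ : F ξ < c
      · have heq : Set.Ici ξ ∩ {p | F p < c} = Set.Ici ξ :=
          Set.inter_eq_left.2 fun p hp => (hF hp).trans_lt hξ
        rw [heq]
        exact isClosed_Ici ξ
      -- Now F is constant with a value at least c on V(ξ) outside V(f), so the sublevel set lies in
      -- the finitely many components of V(ξ) ∩ V(f), whose generic points are strictly above ξ.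
      · obtain ⟨f, hf, hfp⟩ := hgen ξ
        have hT : IsClosed (Set.Ici ξ ∩ zeroLocus {f}) :=
          (isClosed_Ici ξ).inter (isClosed_zeroLocus _)
        have heq : Set.Ici ξ ∩ {p | F p < c} =
            ⋃ q ∈ {q | Minimal (· ∈ Set.Ici ξ ∩ zeroLocus {f}) q},
              Set.Ici q ∩ {p | F p < c} := by
          ext p
          simp only [Set.mem_iUnion]
          constructor
          · rintro ⟨hp, hpc⟩
            have hfmem : f ∈ p.asIdeal := by
              by_contra h
              exact hξ (hfp p hp h ▸ hpc)
            obtain ⟨q, hq, hqp⟩ := exists_minimal_le_of_isClosed hT (p := p)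
              ⟨hp, Set.singleton_subset_iff.2 hfmem⟩
            exact ⟨q, hq, hqp, hpc⟩
          · rintro ⟨q, hq, hqp, hpc⟩
            exact ⟨Set.mem_Ici.2 ((Set.mem_Ici.1 hq.1.1).trans hqp), hpc⟩
        rw [heq]
        refine (finite_minimal_of_isClosed hT).isClosed_biUnion fun q hq => ih q ?_
        refine lt_of_le_of_ne hq.1.1 ?_
        rintro rfl
        exact hf (Set.singleton_subset_iff.1 hq.1.2)
  have h := key ⊥
  rwa [Set.Ici_bot, Set.univ_inter] at h

/-- A set of primes such that the intersections of the irreducible closed subsets defined by its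
members are again unions of such subsets. -/
def IsInterClosed (s : Set (PrimeSpectrum R)) : Prop :=
  ∀ η ∈ s, ∀ η' ∈ s, ∀ p, η ≤ p → η' ≤ p → ∃ ζ ∈ s, η ≤ ζ ∧ η' ≤ ζ ∧ ζ ≤ p

/-- Noetherian induction on T: the generic points of its components are added to a set obtained
inside a strictly smaller closed set. -/
theorem exists_isInterClosed_of_closeds (T : TopologicalSpace.Closeds (PrimeSpectrum R)) :
    ∀ s₀ : Set (PrimeSpectrum R), s₀.Finite → s₀ ⊆ T →
      ∃ s : Set (PrimeSpectrum R), s.Finite ∧ s₀ ⊆ s ∧ s ⊆ T ∧ IsInterClosed s := by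
  induction T using WellFoundedLT.induction with
  | _ T ih =>
    intro s₀ hs₀ hs₀T
    rcases (T : Set (PrimeSpectrum R)).eq_empty_or_nonempty with hT | ⟨p₀, hp₀⟩
    · exact ⟨s₀, hs₀, subset_rfl, hs₀T, fun η hη => absurd (hs₀T hη) (by simp [hT])⟩
    let M : Set (PrimeSpectrum R) := {p | Minimal (· ∈ T) p}
    have hM : M.Finite := finite_minimal_of_isClosed T.isClosed
    have hmin {p τ : PrimeSpectrum R} (hp : p ∈ T) (hτ : τ ∈ M) (h : p ≤ τ) : p = τ :=
      le_antisymm h (hτ.2 hp h)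
    -- Closures of the given non-generic points and intersections of distinct components; B misses
    -- every generic point in M.
    let B : Set (PrimeSpectrum R) := (⋃ η ∈ s₀ \ M, Set.Ici η) ∪
      ⋃ x ∈ (M ×ˢ M) ∩ {x | x.1 ≠ x.2}, Set.Ici x.1 ∩ Set.Ici x.2
    have hB : IsClosed B :=
      ((hs₀.subset Set.sdiff_subset).isClosed_biUnion fun η _ => isClosed_Ici η).union
        (((hM.prod hM).subset Set.inter_subset_left).isClosed_biUnion fun x _ =>
          (isClosed_Ici x.1).inter (isClosed_Ici x.2))
    have hBT : B ⊆ T := by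
      rintro p (hp | hp)
      · simp only [Set.mem_iUnion] at hp
        obtain ⟨η, hη, hp⟩ := hp
        exact mem_of_le_of_isClosed T.isClosed (hs₀T hη.1) hp
      · simp only [Set.mem_iUnion] at hp
        obtain ⟨x, hx, hp⟩ := hp
        exact mem_of_le_of_isClosed T.isClosed hx.1.1.1 hp.1
    have hMB {τ : PrimeSpectrum R} (hτ : τ ∈ M) : τ ∉ B := by
      rintro (hp | hp)
      · simp only [Set.mem_iUnion] at hp
        obtain ⟨η, hη, hp⟩ := hp
        exact hη.2 (hmin (hs₀T hη.1) hτ hp ▸ hτ)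
      · simp only [Set.mem_iUnion] at hp
        obtain ⟨x, hx, hp⟩ := hp
        exact hx.2 ((hmin hx.1.1.1 hτ hp.1).trans (hmin hx.1.2.1 hτ hp.2).symm)
    let T' : TopologicalSpace.Closeds (PrimeSpectrum R) := ⟨B, hB⟩
    have hlt : T' < T := by
      obtain ⟨τ, hτ, -⟩ := exists_minimal_le_of_isClosed T.isClosed hp₀
      exact lt_of_le_of_ne hBT fun h => hMB hτ (show τ ∈ T' from h ▸ hτ.1)
    have hBi (τ) : IsClosed (B ∩ Set.Ici τ) := hB.inter (isClosed_Ici τ)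
    -- The generic points of B ∩ V(τ) are put in, so that intersections of V(τ) with closures of
    -- members of s are covered too.
    obtain ⟨s, hs, hs₀s, hsB, hsi⟩ := ih T' hlt
      ((s₀ \ M) ∪ ⋃ τ ∈ M, {p | Minimal (· ∈ B ∩ Set.Ici τ) p})
      ((hs₀.subset Set.sdiff_subset).union
        (hM.biUnion fun τ _ => finite_minimal_of_isClosed (hBi τ))) (by
      rintro p (hp | hp)
      · exact Or.inl (Set.mem_biUnion hp (Set.mem_Ici.2 le_rfl))
      · simp only [Set.mem_iUnion] at hp
        obtain ⟨τ, _, hp⟩ := hp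
        exact hp.1.1)
    have hex {τ p : PrimeSpectrum R} (hτ : τ ∈ M) (hp : p ∈ B) (h : τ ≤ p) :
        ∃ ζ ∈ s, τ ≤ ζ ∧ ζ ≤ p := by
      obtain ⟨ζ, hζ, hζp⟩ := exists_minimal_le_of_isClosed (hBi τ) (p := p) ⟨hp, h⟩
      exact ⟨ζ, hs₀s (Or.inr (Set.mem_biUnion hτ hζ)), hζ.1.2, hζp⟩
    have hmixed {τ η p : PrimeSpectrum R} (hτ : τ ∈ M) (hη : η ∈ s) (h : τ ≤ p) (h' : η ≤ p) :
        ∃ ζ ∈ s, τ ≤ ζ ∧ η ≤ ζ ∧ ζ ≤ p := by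
      obtain ⟨ζ, hζ, hτζ, hζp⟩ := hex hτ (mem_of_le_of_isClosed hB (hsB hη) h') h
      obtain ⟨θ, hθ, h1, h2, h3⟩ := hsi ζ hζ η hη p hζp h'
      exact ⟨θ, hθ, hτζ.trans h1, h2, h3⟩
    refine ⟨s ∪ M, hs.union hM, fun η hη => ?_, Set.union_subset (hsB.trans hBT) fun τ hτ => hτ.1,
      ?_⟩
    · by_cases h : η ∈ M
      · exact Or.inr h
      · exact Or.inl (hs₀s (Or.inl ⟨hη, h⟩))
    · rintro η (hη | hη) η' (hη' | hη') p hp hp'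
      · obtain ⟨ζ, hζ, h⟩ := hsi η hη η' hη' p hp hp'
        exact ⟨ζ, Or.inl hζ, h⟩
      · obtain ⟨ζ, hζ, h1, h2, h3⟩ := hmixed hη' hη hp' hp
        exact ⟨ζ, Or.inl hζ, h2, h1, h3⟩
      · obtain ⟨ζ, hζ, h⟩ := hmixed hη hη' hp hp'
        exact ⟨ζ, Or.inl hζ, h⟩
      · by_cases hne : η = η'
        · subst hne
          exact ⟨η, Or.inr hη, le_rfl, le_rfl, hp⟩
        · have hpB : p ∈ B := Or.inr (Set.mem_biUnion (x := (η, η')) ⟨⟨hη, hη'⟩, hne⟩ ⟨hp, hp'⟩)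
          obtain ⟨θ, hθ, h1, h2⟩ := hex hη' hpB hp'
          obtain ⟨ζ, hζ, h3, h4, h5⟩ := hmixed hη hθ hp h2
          exact ⟨ζ, Or.inl hζ, h3, h1.trans h4, h5⟩

theorem exists_isInterClosed {s₀ : Set (PrimeSpectrum R)} (h : s₀.Finite) :
    ∃ s : Set (PrimeSpectrum R), s.Finite ∧ s₀ ⊆ s ∧ IsInterClosed s := by
  obtain ⟨s, h1, h2, -, h3⟩ := exists_isInterClosed_of_closeds (R := R) ⊤ s₀ h (Set.subset_univ _)
  exact ⟨s, h1, h2, h3⟩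

/-- The points of the closure of `η` that do not lie in the closure of a point of `s` outside the
generizations of `η`. -/
def stratum (s : Set (PrimeSpectrum R)) (η : PrimeSpectrum R) : Set (PrimeSpectrum R) :=
  {p | η ≤ p ∧ ∀ η' ∈ s, η' ≤ p → η' ≤ η}

-- A maximal member η of s below p works: for η' in s below p, some ζ in s lies above both and below
-- p, and maximality gives ζ ≤ η.
omit [IsNoetherianRing R] in
theorem IsInterClosed.exists_mem_stratum {s : Set (PrimeSpectrum R)} (hs : s.Finite)
    (hi : IsInterClosed s) {ξ p : PrimeSpectrum R} (hξ : ξ ∈ s) (h : ξ ≤ p) :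
    ∃ η ∈ s, p ∈ stratum s η := by
  obtain ⟨η, hη⟩ := (hs.subset (Set.sep_subset s (· ≤ p))).exists_maximal ⟨ξ, hξ, h⟩
  refine ⟨η, hη.1.1, hη.1.2, fun η' hη' h' => ?_⟩
  obtain ⟨ζ, hζ, h1, h2, h3⟩ := hi η hη.1.1 η' hη' p hη.1.2 h'
  exact h2.trans (hη.2 ⟨hζ, h3⟩ h1)

-- Each stratum contains its η, so its closure is V(η), the union of the strata of the members above
-- η.
omit [IsNoetherianRing R] in
theorem IsInterClosed.isFiniteStratification {s : Set (PrimeSpectrum R)} (hs : s.Finite)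
    (hi : IsInterClosed s) (hcover : ∀ p, ∃ ξ ∈ s, ξ ≤ p) :
    IsFiniteStratification (stratum s '' s) where
  finite := hs.image _
  nonempty := by
    rintro _ ⟨η, hη, rfl⟩
    exact ⟨η, le_rfl, fun _ _ h => h⟩
  pairwiseDisjoint := by
    rintro _ ⟨η, hη, rfl⟩ _ ⟨η', hη', rfl⟩ hne
    refine Set.disjoint_left.2 fun p hp hp' => hne ?_
    rw [le_antisymm (hp'.2 η hη hp.1) (hp.2 η' hη' hp'.1)]
  sUnion_eq := by
    refine Set.eq_univ_of_forall fun p => ?_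
    obtain ⟨ξ, hξ, h⟩ := hcover p
    obtain ⟨η, hη, hp⟩ := hi.exists_mem_stratum hs hξ h
    exact ⟨_, ⟨η, hη, rfl⟩, hp⟩
  isLocallyClosed := by
    rintro _ ⟨η, hη, rfl⟩
    have h : stratum s η = (⋃ η' ∈ {η' ∈ s | ¬ η' ≤ η}, Set.Ici η')ᶜ ∩ Set.Ici η := by
      ext p
      simp only [stratum, Set.mem_ofPred_eq, Set.mem_inter_iff, Set.mem_compl_iff, Set.mem_iUnion,
        Set.mem_Ici, not_exists, exists_prop, not_and, and_imp]
      constructor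
      · exact fun h => ⟨fun η' h1 h2 h3 => h2 (h.2 η' h1 h3), h.1⟩
      · exact fun h => ⟨h.2, fun η' h1 h2 => by_contra fun h3 => h.1 η' h1 h3 h2⟩
    rw [h]
    exact ((((hs.subset (Set.sep_subset _ _)).isClosed_biUnion fun η' _ =>
      isClosed_Ici η').isOpen_compl).isLocallyClosed).inter (isClosed_Ici η).isLocallyClosed
  closure_eq := by
    rintro _ ⟨η, hη, rfl⟩
    have hcl : closure (stratum s η) = Set.Ici η := by
      refine Set.Subset.antisymm (closure_minimal (fun p hp => hp.1) (isClosed_Ici η)) fun p hp => ?_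
      exact mem_of_le_of_isClosed isClosed_closure
        (subset_closure (show η ∈ stratum s η from ⟨le_rfl, fun _ _ h => h⟩)) hp
    refine ⟨stratum s '' {η' ∈ s | η ≤ η'}, Set.image_mono (Set.sep_subset _ _), ?_⟩
    rw [hcl]
    ext p
    constructor
    · intro hp
      obtain ⟨η', hη', hp'⟩ := hi.exists_mem_stratum hs hη hp
      exact ⟨_, ⟨η', ⟨hη', hp'.2 η hη hp⟩, rfl⟩, hp'⟩
    · rintro ⟨_, ⟨η', hη', rfl⟩, hp⟩
      exact hη'.2.trans hp.1

/-- An antitone, generically constant function on the spectrum of a noetherian domain is constant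
on the strata of a finite stratification. -/
theorem exists_stratification [IsDomain R] {F : PrimeSpectrum R → ℕ} (hF : Antitone F)
    (hgen : ∀ ξ, ∃ f ∉ ξ.asIdeal, ∀ p, ξ ≤ p → f ∉ p.asIdeal → F p = F ξ) :
    ∃ s : Set (PrimeSpectrum R), s.Finite ∧ IsFiniteStratification (stratum s '' s) ∧
      ∀ η ∈ s, stratum s η ⊆ {p | η ≤ p ∧ F p = F η} := by
  have hclosed (c : ℕ) : IsClosed {p | F p ≤ c} := by
    simpa only [Nat.lt_succ_iff] using isClosed_lt_of_generic hF hgen (c + 1)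
  -- By antitonicity `F ⊥` is the largest value, so finitely many levels suffice.
  obtain ⟨s, hs, hs₀, hi⟩ := exists_isInterClosed (R := R)
    (s₀ := ⋃ c ∈ Set.Iic (F ⊥), {p | Minimal (· ∈ {p | F p ≤ c}) p})
    ((Set.finite_Iic _).biUnion fun c _ => finite_minimal_of_isClosed (hclosed c))
  have hex (p) : ∃ ξ ∈ s, ξ ≤ p ∧ F ξ ≤ F p := by
    obtain ⟨ξ, hξ, hle⟩ := exists_minimal_le_of_isClosed (hclosed (F p)) (p := p) (le_refl (F p))
    exact ⟨ξ, hs₀ (Set.mem_biUnion (hF bot_le) hξ), hle, hξ.1⟩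
  refine ⟨s, hs, hi.isFiniteStratification hs fun p => ?_, fun η _ p hp => ⟨hp.1, ?_⟩⟩
  · obtain ⟨ξ, hξ, h, -⟩ := hex p
    exact ⟨ξ, hξ, h⟩
  -- Membership in the stratum gives ξ ≤ η, hence F η ≤ F ξ ≤ F p ≤ F η.
  · obtain ⟨ξ, hξ, h, h'⟩ := hex p
    exact le_antisymm (hF hp.1) ((hF (hp.2 ξ hξ h)).trans h')

end Topology

end DecompositionMaps

/-! ### The main theorem. -/

theorem theorem2p3 {R : Type u} [CommRing R] [IsDomain R] [IsNoetherianRing R]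
    {A : Type v} [Ring A] [Algebra R A] [Module.Finite R A] [Module.Free R A]
    (hsplit : ∀ p : PrimeSpectrum R,
      IsSplit p.asIdeal.ResidueField (p.asIdeal.ResidueField ⊗[R] A)) :
    IsOpen (decGen R A) ∧ (⊥ : PrimeSpectrum R) ∈ decGen R A ∧
    (∃ s : Finset (PrimeSpectrum R),
      (⋃ ξ ∈ s, decGenAt R A ξ) = Set.univ ∧
      (∀ ξ ∈ s, IsLocallyClosed (decGenAt R A ξ)) ∧
      ∃ 𝒮 : Set (Set (PrimeSpectrum R)), IsFiniteStratification 𝒮 ∧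
        ∀ Y ∈ 𝒮, ∃ ξ ∈ s, Y ⊆ decGenAt R A ξ) ∧
    PrimeSpectrum.zeroLocus (decDiscriminant R A : Set R) = (decGen R A)ᶜ := by
  have hF := fiberRank_antitone hsplit
  have hclosed (c : ℕ) : IsClosed {p : PrimeSpectrum R | fiberRank A p < c} :=
    isClosed_lt_of_generic hF (exists_fiberRank_eq hsplit) c
  have hcompl : (decGen R A)ᶜ = {p | fiberRank A p < fiberRank A (⊥ : PrimeSpectrum R)} := by
    ext p
    rw [decGen_eq hsplit]
    exact (lt_iff_le_and_ne.trans (and_iff_right (hF bot_le))).symm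
  have hc : IsClosed (decGen R A)ᶜ := hcompl ▸ hclosed _
  refine ⟨isClosed_compl_iff.1 hc, ?_, ?_, ?_⟩
  · rw [decGen_eq hsplit]
    rfl
  · obtain ⟨s, hs, hstrat, hsub⟩ := exists_stratification hF (exists_fiberRank_eq hsplit)
    have hsub' (η) (hη : η ∈ s) : stratum s η ⊆ decGenAt R A η := by
      rw [decGenAt_eq hsplit]
      exact hsub η hη
    refine ⟨hs.toFinset, ?_, fun ξ _ => ?_, _, hstrat, ?_⟩
    · refine Set.eq_univ_of_forall fun p => ?_
      obtain ⟨_, ⟨η, hη, rfl⟩, hp⟩ : p ∈ ⋃₀ (stratum s '' s) := hstrat.sUnion_eq ▸ Set.mem_univ p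
      exact Set.mem_biUnion (hs.mem_toFinset.2 hη) (hsub' η hη hp)
    -- On V(ξ) the value at ξ is the maximum, so attaining it is an open condition there.
    · have h : decGenAt R A ξ = Set.Ici ξ ∩ {p | fiberRank A p < fiberRank A ξ}ᶜ := by
        rw [decGenAt_eq hsplit]
        ext p
        exact and_congr_right fun hp =>
          ⟨fun h => not_lt.2 h.ge, fun h => le_antisymm (hF hp) (not_lt.1 h)⟩
      rw [h]
      exact (isClosed_Ici ξ).isLocallyClosed.inter (hclosed _).isOpen_compl.isLocallyClosed
    · rintro _ ⟨η, hη, rfl⟩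
      exact ⟨η, hs.mem_toFinset.2 hη, hsub' η hη⟩
  · rw [decDiscriminant, PrimeSpectrum.zeroLocus_vanishingIdeal_eq_closure, hc.closure_eq]
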